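/- Let $\mathcal H$ be an infinite-dimensional complex Hilbert space. For real $p\ge 1$ let $S_p(\mathcal H)$ be the Banach algebra, under composition, of all $T\in B(\mathcal H)$ with $\|T\|_p:=\operatorname{Tr}(|T|^p)^{1/p}<\infty$, normed by $\|\cdot\|_p$. Put $\mathcal K:=S_2(\mathcal H)$, which is a Hilbert space in the norm $\|\cdot\|_2$, and let $B(\mathcal K)$ and $B_0(\mathcal K)$ be the Banach algebras of bounded and of compact linear operators on $\mathcal K$, with the operator norm. For Banach algebras $A$ and $B$ let $A\otimes^\gamma B$ be the completion of $A\otimes B$, with product $(a\otimes b)(a'\otimes b')=aa'\otimes bb'$, in the projective norm $\|u\|_\gamma=\inf\{\sum_{i=1}^n\|x_i\|\|y_i\| : u=\sum_{i=1}^n x_i\otimes y_i\}$. For a Banach algebra $A$, $f,g\in A^{**}$ and $\omega\in A^*$ let $(f\,\Box\,g)(\omega)=f\big(a\mapsto g(b\mapsto\omega(ab))\big)$ and $(f\diamond g)(\omega)=g\big(b\mapsto f(a\mapsto\omega(ab))\big)$; $A$ is called Arens regular if $f\,\Box\,g=f\diamond g$ for all $f,g\in A^{**}$. Then for every real $p$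 with $1\le p\le 2$, neither of the Banach algebras $B(\mathcal K)\otimes^\gamma S_p(\mathcal H)$ and $B_0(\mathcal K)\otimes^\gamma S_p(\mathcal H)$ is Arens regular. -/

import Mathlib

open scoped TensorProduct InnerProductSpace ENNReal NNReal

set_option linter.unusedSectionVars false

noncomputable section

/-! ### Arens products and Arens regularity -/

section Arens

variable {A : Type*} [NonUnitalSeminormedRing A] [NormedSpace ℂ A] [IsScalarTower ℂ A A]
  [SMulCommClass ℂ A A]

/-- `ω ↦ (a ↦ ω_a)`, where `ω_a = (L_a)^* ω`, that is `ω_a (b) = ω (a b)`. -/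
def arensLeft : StrongDual ℂ A →L[ℂ] A →L[ℂ] StrongDual ℂ A :=
  (ContinuousLinearMap.compL ℂ A (A →L[ℂ] A) (StrongDual ℂ A)).flip
    (ContinuousLinearMap.mul ℂ A) ∘L ContinuousLinearMap.compL ℂ A A ℂ

/-- `ω ↦ (a ↦ ₐω)`, where `ₐω = (R_a)^* ω`, that is `ₐω (b) = ω (b a)`. -/
def arensRight : StrongDual ℂ A →L[ℂ] A →L[ℂ] StrongDual ℂ A :=
  (ContinuousLinearMap.compL ℂ A (A →L[ℂ] A) (StrongDual ℂ A)).flip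
    (ContinuousLinearMap.mul ℂ A).flip ∘L ContinuousLinearMap.compL ℂ A A ℂ

theorem arensLeft_apply (ω : StrongDual ℂ A) (a b : A) : arensLeft ω a b = ω (a * b) := rfl

theorem arensRight_apply (ω : StrongDual ℂ A) (a b : A) : arensRight ω a b = ω (b * a) := rfl

/-- The first Arens product `f □ g` on the bidual: `(f □ g) (ω) = f (a ↦ g (ω_a))`. -/
def arensBox (f g : StrongDual ℂ (StrongDual ℂ A)) : StrongDual ℂ (StrongDual ℂ A) :=
  f ∘L (ContinuousLinearMap.compL ℂ A (StrongDual ℂ A) ℂ g ∘L arensLeft)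

/-- The second Arens product `f ⋄ g` on the bidual: `(f ⋄ g) (ω) = g (a ↦ f (ₐω))`. -/
def arensDiamond (f g : StrongDual ℂ (StrongDual ℂ A)) : StrongDual ℂ (StrongDual ℂ A) :=
  g ∘L (ContinuousLinearMap.compL ℂ A (StrongDual ℂ A) ℂ f ∘L arensRight)

theorem arensBox_apply (f g : StrongDual ℂ (StrongDual ℂ A)) (ω : StrongDual ℂ A) :
    arensBox f g ω = f (g ∘L arensLeft ω) := rfl

theorem arensDiamond_apply (f g : StrongDual ℂ (StrongDual ℂ A)) (ω : StrongDual ℂ A) :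
    arensDiamond f g ω = g (f ∘L arensRight ω) := rfl

variable (A) in
/-- A normed algebra is Arens regular if its two Arens products agree on the bidual. -/
def ArensRegular : Prop :=
  ∀ f g : StrongDual ℂ (StrongDual ℂ A), arensBox f g = arensDiamond f g

end Arens

/-! ### The projective tensor product of normed algebras -/

section Projective

variable (A B : Type*)
  [NonUnitalNormedRing A] [NormedSpace ℂ A] [IsScalarTower ℂ A A] [SMulCommClass ℂ A A]
  [NonUnitalNormedRing B] [NormedSpace ℂ B] [IsScalarTower ℂ B B] [SMulCommClass ℂ B B]

/-- The algebraic tensor product `A ⊗ B` over `ℂ` with `(a ⊗ b) (a' ⊗ b') = a a' ⊗ b b'`; this is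
a copy of `A ⊗[ℂ] B` which is going to carry the projective norm. -/
def AlgTensor : Type _ := A ⊗[ℂ] B

instance : NonUnitalRing (AlgTensor A B) := inferInstanceAs (NonUnitalRing (A ⊗[ℂ] B))
instance : Module ℂ (AlgTensor A B) := inferInstanceAs (Module ℂ (A ⊗[ℂ] B))
instance : IsScalarTower ℂ (AlgTensor A B) (AlgTensor A B) :=
  inferInstanceAs (IsScalarTower ℂ (A ⊗[ℂ] B) (A ⊗[ℂ] B))
instance : SMulCommClass ℂ (AlgTensor A B) (AlgTensor A B) :=
  inferInstanceAs (SMulCommClass ℂ (A ⊗[ℂ] B) (A ⊗[ℂ] B))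

variable {A B}

/-- The elementary tensor `a ⊗ b`. -/
def AlgTensor.tmul (a : A) (b : B) : AlgTensor A B := (a ⊗ₜ[ℂ] b : A ⊗[ℂ] B)

namespace AlgTensor

theorem tmul_mul_tmul (a a' : A) (b b' : B) :
    tmul a b * tmul a' b' = tmul (a * a') (b * b') :=
  Algebra.TensorProduct.tmul_mul_tmul a a' b b'

theorem smul_tmul (c : ℂ) (a : A) (b : B) : c • tmul a b = tmul (c • a) b :=
  TensorProduct.smul_tmul' c a b

/-- The values `∑ ‖xᵢ‖ ‖yᵢ‖` over all finite representations `u = ∑ xᵢ ⊗ yᵢ`. -/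
def costs (u : AlgTensor A B) : Set ℝ :=
  {r | ∃ (n : ℕ) (x : Fin n → A) (y : Fin n → B),
    u = ∑ i, tmul (x i) (y i) ∧ r = ∑ i, ‖x i‖ * ‖y i‖}

/-- The projective norm `‖u‖_γ = inf {∑ ‖xᵢ‖ ‖yᵢ‖ : u = ∑ xᵢ ⊗ yᵢ}`. -/
def projNorm (u : AlgTensor A B) : ℝ := sInf (costs u)

theorem costs_zero_mem : (0 : ℝ) ∈ costs (0 : AlgTensor A B) :=
  ⟨0, Fin.elim0, Fin.elim0, by simp, by simp⟩

theorem costs_tmul_mem (a : A) (b : B) : ‖a‖ * ‖b‖ ∈ costs (tmul a b) :=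
  ⟨1, fun _ => a, fun _ => b, by simp, by simp⟩

theorem costs_add_mem {u v : AlgTensor A B} {r s : ℝ} (hr : r ∈ costs u) (hs : s ∈ costs v) :
    r + s ∈ costs (u + v) := by
  obtain ⟨n, x, y, rfl, rfl⟩ := hr
  obtain ⟨m, x', y', rfl, rfl⟩ := hs
  refine ⟨n + m, Fin.append x x', Fin.append y y', ?_, ?_⟩ <;> simp [Fin.sum_univ_add]

theorem costs_nonneg {u : AlgTensor A B} {r : ℝ} (hr : r ∈ costs u) : 0 ≤ r := by
  obtain ⟨n, x, y, -, rfl⟩ := hr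
  positivity

theorem costs_sum_mem {ι : Type*} (s : Finset ι) (u : ι → AlgTensor A B) (r : ι → ℝ)
    (h : ∀ i ∈ s, r i ∈ costs (u i)) : ∑ i ∈ s, r i ∈ costs (∑ i ∈ s, u i) := by
  classical
  induction s using Finset.induction_on with
  | empty => simpa using costs_zero_mem
  | insert i s hi ih =>
    rw [Finset.sum_insert hi, Finset.sum_insert hi]
    exact costs_add_mem (h i (by simp)) (ih fun j hj => h j (by simp [hj]))

theorem costs_nonempty (u : AlgTensor A B) : (costs u).Nonempty := by
  refine TensorProduct.induction_on (motive := fun u => (costs (A := A) (B := B) u).Nonempty) u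
    ⟨0, costs_zero_mem⟩ (fun a b => ⟨_, costs_tmul_mem a b⟩) ?_
  rintro x y ⟨r, hr⟩ ⟨s, hs⟩
  exact ⟨_, costs_add_mem hr hs⟩

theorem costs_bddBelow (u : AlgTensor A B) : BddBelow (costs u) := ⟨0, fun _ h => costs_nonneg h⟩

theorem projNorm_le {u : AlgTensor A B} {r : ℝ} (hr : r ∈ costs u) : projNorm u ≤ r :=
  csInf_le (costs_bddBelow u) hr

theorem projNorm_nonneg (u : AlgTensor A B) : 0 ≤ projNorm u :=
  Real.sInf_nonneg fun _ h => costs_nonneg h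

theorem exists_cost_lt (u : AlgTensor A B) {ε : ℝ} (hε : 0 < ε) :
    ∃ r ∈ costs u, r < projNorm u + ε :=
  exists_lt_of_csInf_lt (costs_nonempty u) (lt_add_of_pos_right _ hε)

theorem costs_smul_mem (c : ℂ) {u : AlgTensor A B} {r : ℝ} (hr : r ∈ costs u) :
    ‖c‖ * r ∈ costs (c • u) := by
  obtain ⟨n, x, y, rfl, rfl⟩ := hr
  refine ⟨n, fun i => c • x i, y, ?_, ?_⟩
  · simp [Finset.smul_sum, smul_tmul]
  · simp [Finset.mul_sum, norm_smul, mul_assoc]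

theorem projNorm_add_le (u v : AlgTensor A B) : projNorm (u + v) ≤ projNorm u + projNorm v := by
  refine le_of_forall_pos_le_add fun ε hε => ?_
  obtain ⟨r, hr, hr'⟩ := exists_cost_lt u (half_pos hε)
  obtain ⟨s, hs, hs'⟩ := exists_cost_lt v (half_pos hε)
  linarith [projNorm_le (costs_add_mem hr hs)]

theorem projNorm_smul_le (c : ℂ) (u : AlgTensor A B) : projNorm (c • u) ≤ ‖c‖ * projNorm u := by
  have key : ∀ r ∈ costs u, projNorm (c • u) ≤ ‖c‖ * r := fun r hr =>
    projNorm_le (costs_smul_mem c hr)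
  obtain ⟨v, -, hv, hv'⟩ := exists_seq_tendsto_sInf (costs_nonempty u) (costs_bddBelow u)
  exact ge_of_tendsto' (hv.const_mul ‖c‖) fun n => key _ (hv' n)

theorem projNorm_neg (u : AlgTensor A B) : projNorm (-u) = projNorm u := by
  have h : ∀ u : AlgTensor A B, projNorm (-u) ≤ projNorm u := fun u => by
    simpa using projNorm_smul_le (-1) u
  exact le_antisymm (h u) (by simpa using h (-u))

theorem projNorm_mul_le (u v : AlgTensor A B) : projNorm (u * v) ≤ projNorm u * projNorm v := by
  have key : ∀ r ∈ costs u, ∀ s ∈ costs v, projNorm (u * v) ≤ r * s := by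
    rintro r ⟨n, x, y, rfl, rfl⟩ s ⟨m, x', y', rfl, rfl⟩
    rw [Finset.sum_mul_sum, Finset.sum_mul_sum]
    refine (projNorm_le (costs_sum_mem _ _ (fun i => ∑ j, ‖x i * x' j‖ * ‖y i * y' j‖)
      fun i _ => costs_sum_mem _ _ (fun j => ‖x i * x' j‖ * ‖y i * y' j‖) fun j _ => ?_)).trans ?_
    · rw [tmul_mul_tmul]
      exact costs_tmul_mem _ _
    · refine Finset.sum_le_sum fun i _ => Finset.sum_le_sum fun j _ => ?_
      calc ‖x i * x' j‖ * ‖y i * y' j‖ ≤ (‖x i‖ * ‖x' j‖) * (‖y i‖ * ‖y' j‖) := by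
            gcongr <;> exact norm_mul_le _ _
        _ = _ := by ring
  obtain ⟨a, -, ha, ha'⟩ := exists_seq_tendsto_sInf (costs_nonempty u) (costs_bddBelow u)
  obtain ⟨b, -, hb, hb'⟩ := exists_seq_tendsto_sInf (costs_nonempty v) (costs_bddBelow v)
  exact ge_of_tendsto' (ha.mul hb) fun n => key _ (ha' n) _ (hb' n)

instance : NonUnitalSeminormedRing (AlgTensor A B) :=
  { AddGroupSeminorm.toSeminormedAddCommGroup (E := AlgTensor A B)
      { toFun := projNorm
        map_zero' := le_antisymm (projNorm_le costs_zero_mem) (projNorm_nonneg _)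
        add_le' := projNorm_add_le
        neg' := projNorm_neg },
    (inferInstance : NonUnitalRing (AlgTensor A B)) with
    norm_mul_le := projNorm_mul_le }

theorem norm_def (u : AlgTensor A B) : ‖u‖ = projNorm u := rfl

instance : NormedSpace ℂ (AlgTensor A B) where
  norm_smul_le := projNorm_smul_le

end AlgTensor

variable (A B) in
/-- The Banach algebra `A ⊗^γ B`: the completion of `A ⊗ B` in the projective norm. -/
def ProjTensor : Type _ := UniformSpace.Completion (AlgTensor A B)

namespace ProjTensor

open ContinuousLinearMap UniformSpace

instance : NormedAddCommGroup (ProjTensor A B) :=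
  inferInstanceAs (NormedAddCommGroup (Completion (AlgTensor A B)))
instance : NormedSpace ℂ (ProjTensor A B) :=
  inferInstanceAs (NormedSpace ℂ (Completion (AlgTensor A B)))
instance : CompleteSpace (ProjTensor A B) :=
  inferInstanceAs (CompleteSpace (Completion (AlgTensor A B)))

variable (A B) in
/-- The canonical map of the algebraic tensor product into its completion. -/
def ofAlg : AlgTensor A B →L[ℂ] ProjTensor A B :=
  (Completion.toComplL : AlgTensor A B →L[ℂ] Completion (AlgTensor A B))

theorem norm_ofAlg (u : AlgTensor A B) : ‖ofAlg A B u‖ = ‖u‖ := Completion.norm_coe u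

theorem denseRange_ofAlg : DenseRange (ofAlg A B) := Completion.denseRange_coe

theorem isUniformInducing_ofAlg : IsUniformInducing (ofAlg A B) :=
  Completion.isUniformInducing_coe _

variable (A B) in
/-- The multiplication of `A ⊗ B`, extended to the completion by continuity in each variable. -/
def mulL : ProjTensor A B →L[ℂ] ProjTensor A B →L[ℂ] ProjTensor A B :=
  (((((compL ℂ (AlgTensor A B) (AlgTensor A B) (ProjTensor A B) (ofAlg A B)) ∘L
    ContinuousLinearMap.mul ℂ (AlgTensor A B)).extend (ofAlg A B)).flip).extend (ofAlg A B)).flip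

instance : Mul (ProjTensor A B) := ⟨fun u v => mulL A B u v⟩

theorem mul_def (u v : ProjTensor A B) : u * v = mulL A B u v := rfl

theorem ofAlg_mul (u v : AlgTensor A B) : ofAlg A B (u * v) = ofAlg A B u * ofAlg A B v := by
  rw [mul_def, mulL, flip_apply, extend_eq _ denseRange_ofAlg isUniformInducing_ofAlg, flip_apply,
    extend_eq _ denseRange_ofAlg isUniformInducing_ofAlg]
  rfl

theorem continuous_mul' : Continuous fun q : ProjTensor A B × ProjTensor A B => q.1 * q.2 :=
  (mulL A B).continuous₂

instance : ContinuousMul (ProjTensor A B) := ⟨continuous_mul'⟩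

theorem norm_mul_le' (u v : ProjTensor A B) : ‖u * v‖ ≤ ‖u‖ * ‖v‖ := by
  refine denseRange_ofAlg.induction_on₂ (p := fun u v : ProjTensor A B => ‖u * v‖ ≤ ‖u‖ * ‖v‖)
    ?_ (fun a b => ?_) u v
  · exact isClosed_le (by fun_prop) (by fun_prop)
  · rw [← ofAlg_mul, norm_ofAlg, norm_ofAlg, norm_ofAlg]
    exact norm_mul_le a b

theorem mul_assoc' (u v w : ProjTensor A B) : u * v * w = u * (v * w) := by
  refine denseRange_ofAlg.induction_on₃
    (p := fun u v w : ProjTensor A B => u * v * w = u * (v * w)) ?_ (fun a b c => ?_) u v w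
  · exact isClosed_eq (by fun_prop) (by fun_prop)
  · simp only [← ofAlg_mul, mul_assoc]

instance : NonUnitalNormedRing (ProjTensor A B) :=
  { (inferInstance : NormedAddCommGroup (ProjTensor A B)),
    (inferInstance : Mul (ProjTensor A B)) with
    left_distrib := fun u v w => by simp [mul_def]
    right_distrib := fun u v w => by simp [mul_def]
    zero_mul := fun u => by simp [mul_def]
    mul_zero := fun u => by simp [mul_def]
    mul_assoc := mul_assoc'
    norm_mul_le := norm_mul_le' }

instance : IsScalarTower ℂ (ProjTensor A B) (ProjTensor A B) :=
  ⟨fun c u v => by simp [mul_def]⟩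

instance : SMulCommClass ℂ (ProjTensor A B) (ProjTensor A B) :=
  ⟨fun c u v => by simp [mul_def]⟩

end ProjTensor

end Projective

/-! ### Schatten classes -/

section Schatten

universe u

variable {H : Type u} [NormedAddCommGroup H] [InnerProductSpace ℂ H] [CompleteSpace H]

/-- The canonical trace of a positive operator: `∑ ⟨e, P e⟩ ∈ [0, ∞]` over an orthonormal basis. -/
def posTrace (P : H →L[ℂ] H) : ℝ≥0∞ :=
  ∑' e : (exists_hilbertBasis ℂ H).choose, ENNReal.ofReal (RCLike.re ⟪(e : H), P e⟫_ℂ)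

/-- `Tr(|T|^p)`. -/
def schattenTrace (p : ℝ) (T : H →L[ℂ] H) : ℝ≥0∞ := posTrace (CFC.abs T ^ p)

/-- A family of vectors that satisfies Bessel's inequality. -/
def IsBessel {ι : Type*} (e : ι → H) : Prop := ∀ x : H, ∑' i, ‖⟪e i, x⟫_ℂ‖ₑ ^ 2 ≤ ‖x‖ₑ ^ 2

theorem isBessel_of_orthonormal {ι : Type*} {e : ι → H} (he : Orthonormal ℂ e) : IsBessel e := by
  intro x
  refine ENNReal.summable.tsum_le_of_sum_le fun s => ?_
  have h := he.sum_inner_products_le x (s := s)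
  have := ENNReal.ofReal_le_ofReal h
  rw [ENNReal.ofReal_sum_of_nonneg fun _ _ => by positivity] at this
  simpa only [ENNReal.ofReal_pow (norm_nonneg _), ofReal_norm] using this

theorem hilbertBasis_tsum_enorm_sq {ι : Type*} (b : HilbertBasis ι ℂ H) (x : H) :
    ∑' i, ‖⟪b i, x⟫_ℂ‖ₑ ^ 2 = ‖x‖ₑ ^ 2 := by
  have h2 : HasSum (fun i => ‖⟪b i, x⟫_ℂ‖ ^ 2) (‖x‖ ^ 2) := by
    have := (RCLike.reCLM (K := ℂ)).hasSum (b.hasSum_inner_mul_inner x x)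
    have h1 : RCLike.reCLM (K := ℂ) ⟪x, x⟫_ℂ = ‖x‖ ^ 2 :=
      inner_self_eq_norm_sq (𝕜 := ℂ) x
    have h4 : (fun i => RCLike.reCLM (K := ℂ) (⟪x, b i⟫_ℂ * ⟪b i, x⟫_ℂ)) =
        fun i => ‖⟪b i, x⟫_ℂ‖ ^ 2 := by
      funext i
      change RCLike.re (⟪x, b i⟫_ℂ * ⟪b i, x⟫_ℂ) = _
      rw [inner_mul_symm_re_eq_norm, norm_mul, norm_inner_symm x, sq]
    rw [h4] at this
    exact h1 ▸ this
  have h3 := ENNReal.ofReal_tsum_of_nonneg (fun i => by positivity) h2.summable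
  rw [h2.tsum_eq] at h3
  simpa only [ENNReal.ofReal_pow (norm_nonneg _), ofReal_norm] using h3.symm

/-- `∑ ‖S e‖²` does not depend on the basis. -/
theorem tsum_enorm_sq_adjoint {ι κ : Type*} (S : H →L[ℂ] H) (b : HilbertBasis ι ℂ H)
    (c : HilbertBasis κ ℂ H) :
    ∑' i, ‖S (b i)‖ₑ ^ 2 = ∑' j, ‖(ContinuousLinearMap.adjoint S) (c j)‖ₑ ^ 2 := by
  simp_rw [← hilbertBasis_tsum_enorm_sq c (S (b _)),
    ← hilbertBasis_tsum_enorm_sq b ((ContinuousLinearMap.adjoint S) (c _))]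
  rw [ENNReal.tsum_comm]
  refine tsum_congr fun j => tsum_congr fun i => ?_
  rw [ContinuousLinearMap.adjoint_inner_right, ← inner_conj_symm, RCLike.enorm_conj]

theorem ofReal_inner_sq (Q : H →L[ℂ] H) (hQ : IsSelfAdjoint Q) (x : H) :
    ENNReal.ofReal (RCLike.re ⟪x, (Q * Q) x⟫_ℂ) = ‖Q x‖ₑ ^ 2 := by
  have : ⟪x, (Q * Q) x⟫_ℂ = ⟪Q x, Q x⟫_ℂ := by
    rw [mul_apply_eq_comp, ← ContinuousLinearMap.adjoint_inner_left,
      hQ.adjoint_eq]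
  rw [this, inner_self_eq_norm_sq, ENNReal.ofReal_pow (norm_nonneg _), ofReal_norm]

/-- The trace of a positive operator can be computed in any orthonormal basis. -/
theorem posTrace_eq {ι : Type*} (b : HilbertBasis ι ℂ H) {P : H →L[ℂ] H} (hP : 0 ≤ P) :
    posTrace P = ∑' i, ENNReal.ofReal (RCLike.re ⟪b i, P (b i)⟫_ℂ) := by
  have hQ : IsSelfAdjoint (CFC.sqrt P) := (CFC.sqrt_nonneg P).isSelfAdjoint
  have hPQ : P = CFC.sqrt P * CFC.sqrt P := (CFC.sqrt_mul_sqrt_self P hP).symm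
  obtain ⟨c, hc⟩ := (exists_hilbertBasis ℂ H).choose_spec
  have h1 : posTrace P = ∑' i, ENNReal.ofReal (RCLike.re ⟪c i, P (c i)⟫_ℂ) := by
    rw [hc]; rfl
  rw [h1, hPQ]
  simp_rw [ofReal_inner_sq _ hQ]
  rw [tsum_enorm_sq_adjoint _ b c, hQ.adjoint_eq]

theorem enorm_apply_sq_le {ι : Type*} (b : HilbertBasis ι ℂ H) (R : H →L[ℂ] H) (x : H) :
    ‖R x‖ₑ ^ 2 ≤ (∑' i, ‖R (b i)‖ₑ ^ 2) * ‖x‖ₑ ^ 2 := by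
  rw [tsum_enorm_sq_adjoint R b b, ← hilbertBasis_tsum_enorm_sq b (R x), ← ENNReal.tsum_mul_right]
  refine ENNReal.tsum_le_tsum fun i => ?_
  rw [← ContinuousLinearMap.adjoint_inner_left, ← mul_pow]
  gcongr
  simpa only [enorm, ← ENNReal.coe_mul, ENNReal.coe_le_coe] using! norm_inner_le_norm (𝕜 := ℂ) _ x

/-- An operator with `∑ ‖Q e‖² < ∞` is compact. -/
theorem isCompactOperator_of_tsum_enorm_sq {ι : Type*} (b : HilbertBasis ι ℂ H) (Q : H →L[ℂ] H)
    (h : ∑' i, ‖Q (b i)‖ₑ ^ 2 ≠ ⊤) : IsCompactOperator Q := by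
  classical
  let F : Finset ι → H →L[ℂ] H := fun s =>
    ∑ i ∈ s, (innerSL ℂ (b i)).smulRight (Q (b i))
  have hF : ∀ s, IsCompactOperator (F s) := fun s => by
    refine Submodule.sum_mem (compactOperator (RingHom.id ℂ) H H) fun i _ => ?_
    exact (isCompactOperator_of_locallyCompactSpace_rng
      (ContinuousLinearMap.toSpanSingleton ℂ (Q (b i)))).comp_clm (innerSL ℂ (b i))
  have hFb : ∀ s k, (Q - F s) (b k) = if k ∈ s then 0 else Q (b k) := fun s k => by
    have := b.orthonormal
    rw [orthonormal_iff_ite] at this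
    simp only [F, sub_apply, sum_apply,
      ContinuousLinearMap.smulRight_apply, innerSL_apply_apply, this]
    split_ifs with hk <;> simp [hk]
  have hle : ∀ s, ‖Q - F s‖ₑ ^ 2 ≤ ∑' i : {i // i ∉ s}, ‖Q (b i)‖ₑ ^ 2 := fun s => by
    have h1 : ∑' k, ‖(Q - F s) (b k)‖ₑ ^ 2 = ∑' i : {i // i ∉ s}, ‖Q (b i)‖ₑ ^ 2 := by
      refine Eq.trans ?_ (tsum_subtype {i | i ∉ s} (fun i => ‖Q (b i)‖ₑ ^ 2)).symm
      refine tsum_congr fun k => ?_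
      rw [hFb]
      by_cases hk : k ∈ s <;> simp [Set.indicator, hk]
    rw [← h1]
    have h2 : ‖Q - F s‖ₑ ≤ (∑' k, ‖(Q - F s) (b k)‖ₑ ^ 2) ^ (1 / 2 : ℝ) := by
      by_cases ht : (∑' k, ‖(Q - F s) (b k)‖ₑ ^ 2) = ⊤
      · rw [ht, ENNReal.top_rpow_of_pos (by norm_num)]
        exact le_top
      refine ContinuousLinearMap.opENorm_le_bound _ fun x => ?_
      have h3 := ENNReal.rpow_le_rpow (enorm_apply_sq_le b (Q - F s) x)
        (show (0 : ℝ) ≤ 1 / 2 by norm_num)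
      rw [ENNReal.mul_rpow_of_nonneg _ _ (by norm_num), ← ENNReal.rpow_natCast,
        ← ENNReal.rpow_natCast, ← ENNReal.rpow_mul, ← ENNReal.rpow_mul] at h3
      simpa using h3
    calc ‖Q - F s‖ₑ ^ 2 ≤ ((∑' k, ‖(Q - F s) (b k)‖ₑ ^ 2) ^ (1 / 2 : ℝ)) ^ 2 := by gcongr
      _ = _ := by
        rw [← ENNReal.rpow_natCast, ← ENNReal.rpow_mul]
        simp
  have hlim : Filter.Tendsto (fun s => ‖Q - F s‖ₑ ^ 2) Filter.atTop (nhds 0) :=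
    tendsto_of_tendsto_of_tendsto_of_le_of_le tendsto_const_nhds
      (ENNReal.tendsto_tsum_compl_atTop_zero h) (fun _ => zero_le) hle
  have hlim2 : Filter.Tendsto (fun s => ‖Q - F s‖ₑ) Filter.atTop (nhds 0) := by
    have := (ENNReal.continuous_rpow_const (y := 1 / 2)).tendsto 0 |>.comp hlim
    rw [ENNReal.zero_rpow_of_pos (by norm_num)] at this
    refine this.congr fun s => ?_
    simp only [Function.comp_apply]
    rw [← ENNReal.rpow_natCast, ← ENNReal.rpow_mul]
    simp
  refine isCompactOperator_of_tendsto (l := Filter.atTop) (F := F) ?_ (Filter.Eventually.of_forall hF)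
  rw [tendsto_iff_edist_tendsto_0]
  refine hlim2.congr fun s => ?_
  rw [edist_comm, edist_eq_enorm_sub]

theorem isCompactOperator_of_abs_rpow (T : H →L[ℂ] H) {r : ℝ} (hr : 0 < r)
    (h : IsCompactOperator (CFC.abs T ^ r : H →L[ℂ] H)) : IsCompactOperator T := by
  set A : H →L[ℂ] H := CFC.abs T with hA
  have hA0 : 0 ≤ A := CFC.abs_nonneg T
  have hAs : IsSelfAdjoint A := hA0.isSelfAdjoint
  have hspec : ∀ t ∈ spectrum ℝ A, 0 ≤ t := fun t ht => spectrum_nonneg_of_nonneg hA0 ht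
  let k : ℝ → ℝ → ℝ := fun ε t => max (t - ε) 0 / max t ε
  let j : ℝ → ℝ → ℝ := fun ε t => k ε t / max t ε ^ r
  have hk : ∀ ε > 0, Continuous (k ε) := fun ε hε =>
    Continuous.div (by fun_prop) (by fun_prop) fun t => (lt_max_of_lt_right hε).ne'
  have hj : ∀ ε > 0, Continuous (j ε) := fun ε hε =>
    (hk ε hε).div (Continuous.rpow_const (by fun_prop) fun t => Or.inr hr.le)
      fun t => (Real.rpow_pos_of_pos (lt_max_of_lt_right hε) r).ne'
  have hrp : Continuous fun t : ℝ => t ^ r := Real.continuous_rpow_const hr.le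
  have hkj : ∀ ε > 0, cfc (k ε) A = A ^ r * cfc (j ε) A := fun ε hε => by
    rw [CFC.rpow_eq_cfc_real hA0, ← cfc_mul _ _ A hrp.continuousOn (hj ε hε).continuousOn]
    refine cfc_congr fun t ht => ?_
    have ht0 := hspec t ht
    by_cases hte : t ≤ ε
    · simp [k, j, hte]
    · push Not at hte
      have : max t ε = t := max_eq_left hte.le
      have h0 : t ^ r ≠ 0 := (Real.rpow_pos_of_pos (hε.trans hte) r).ne'
      simp only [j, this]
      field_simp
  have hcomp : ∀ ε > 0, IsCompactOperator (T * cfc (k ε) A : H →L[ℂ] H) := fun ε hε => by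
    rw [hkj ε hε]
    exact (h.comp_clm (cfc (j ε) A)).clm_comp T
  have hnorm : ∀ ε > 0, ‖T - T * cfc (k ε) A‖ ≤ ε := fun ε hε => by
    have hc : Continuous fun t => 1 - k ε t := continuous_const.sub (hk ε hε)
    set D := cfc (fun t => 1 - k ε t) A with hD
    have hDs : IsSelfAdjoint D := cfc_predicate _ _
    have h1 : T - T * cfc (k ε) A = T * D := by
      rw [hD, cfc_sub _ _ A continuousOn_const (hk ε hε).continuousOn, cfc_const_one ℝ A, mul_sub,
        mul_one]
    have hAD : ‖A * D‖ ≤ ε := by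
      have : A * D = cfc (fun t => t * (1 - k ε t)) A := by
        rw [cfc_mul _ _ A (continuousOn_id' _) hc.continuousOn, cfc_id' ℝ A]
      rw [this]
      refine norm_cfc_le hε.le fun t ht => ?_
      have ht0 := hspec t ht
      by_cases hte : t ≤ ε
      · have : k ε t = 0 := by simp [k, hte]
        rw [this, sub_zero, mul_one, Real.norm_of_nonneg ht0]
        exact hte
      · push Not at hte
        have h0 : t ≠ 0 := (hε.trans hte).ne'
        have : t * (1 - k ε t) = ε := by
          simp only [k, max_eq_left hte.le, max_eq_left (sub_pos.2 hte).le]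
          field_simp
          ring
        rw [this, Real.norm_of_nonneg hε.le]
    have h2 : star (T * D) * (T * D) = star (A * D) * (A * D) := by
      simp only [star_mul, hAs.star_eq, mul_assoc]
      rw [← mul_assoc (star T), ← mul_assoc A A, ← CFC.abs_mul_abs T]
    have h3 : ‖T * D‖ * ‖T * D‖ = ‖A * D‖ * ‖A * D‖ := by
      rw [← CStarRing.norm_star_mul_self, h2, CStarRing.norm_star_mul_self]
    rw [h1]
    nlinarith [norm_nonneg (T * D), norm_nonneg (A * D)]
  refine isCompactOperator_of_tendsto (l := Filter.atTop)
    (F := fun n : ℕ => T * cfc (k (1 / ((n : ℝ) + 1))) A) ?_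
    (Filter.Eventually.of_forall fun n => hcomp _ (by positivity))
  rw [tendsto_iff_norm_sub_tendsto_zero]
  refine squeeze_zero (fun _ => norm_nonneg _) (fun n => ?_)
    tendsto_one_div_add_atTop_nhds_zero_nat
  rw [norm_sub_rev]
  exact hnorm _ (by positivity)

theorem cfc_apply_eigenvector {A : H →L[ℂ] H} (hA : IsSelfAdjoint A) {f : ℝ → ℝ}
    (hf : ContinuousOn f (spectrum ℝ A)) {l : ℝ} {u : H} (hu : A u = (l : ℂ) • u) :
    cfc f A u = (f l : ℂ) • u := by
  by_cases hu0 : u = 0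
  · simp [hu0]
  have hl : l ∈ spectrum ℝ A := by
    rw [spectrum.mem_iff]
    intro hunit
    have h0 : (algebraMap ℝ (H →L[ℂ] H) l - A) u = 0 := by
      rw [sub_apply, hu, Algebra.algebraMap_eq_smul_one]
      simp
    obtain ⟨R, hR⟩ := hunit.exists_left_inv
    apply hu0
    have := congrArg (fun S : H →L[ℂ] H => S u) hR
    simpa [mul_apply_eq_comp, h0] using this.symm
  rw [cfc_apply f A hA hf]
  suffices ∀ g : C(spectrum ℝ A, ℝ), cfcHom hA g u = (g ⟨l, hl⟩ : ℂ) • u from this _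
  intro g
  have : CompactSpace (spectrum ℝ A) := by
    exact isCompact_iff_compactSpace.mp (ContinuousFunctionalCalculus.isCompact_spectrum A)
  induction g using ContinuousMap.induction_on_of_compact with
  | const r =>
    have : ContinuousMap.const (spectrum ℝ A) r = algebraMap ℝ C(spectrum ℝ A, ℝ) r := rfl
    rw [this, AlgHomClass.commutes, Algebra.algebraMap_eq_smul_one]
    simp
  | id => rw [cfcHom_id hA, hu]; rfl
  | star_id => rw [map_star, cfcHom_id hA, hA.star_eq, hu]; rfl
  | add f g hf hg => simp [hf, hg, add_smul]
  | mul f g hf hg => simp [hf, hg, mul_smul, smul_comm (g ⟨l, hl⟩)]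
  | frequently f hf =>
    have hc : IsClosed {g : C(spectrum ℝ A, ℝ) | cfcHom hA g u = (g ⟨l, hl⟩ : ℂ) • u} := by
      have h1 : Continuous fun g : C(spectrum ℝ A, ℝ) => cfcHom hA g := cfcHom_continuous hA
      have h2 : Continuous fun g : C(spectrum ℝ A, ℝ) => g ⟨l, hl⟩ :=
        continuous_eval_const _
      exact isClosed_eq (by fun_prop) (by fun_prop)
    exact hc.closure_subset (mem_closure_iff_frequently.2 hf)

theorem exists_hilbertBasis_abs {T : H →L[ℂ] H} (hT : IsCompactOperator T) :
    ∃ (ι : Type u) (b : HilbertBasis ι ℂ H) (s : ι → ℝ≥0),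
      ∀ k, CFC.abs T (b k) = ((s k : ℝ) : ℂ) • b k := by
  set A : H →L[ℂ] H := CFC.abs T with hA
  have hA0 : 0 ≤ A := CFC.abs_nonneg T
  have hAs : IsSelfAdjoint A := hA0.isSelfAdjoint
  have hAc : IsCompactOperator A := by
    refine isCompactOperator_of_abs_rpow A (r := 2) two_pos ?_
    have : CFC.abs A ^ (2 : ℝ) = star T * T := by
      rw [hA, CFC.cfcAbs_cfcAbs, ← CFC.abs_sq, ← CFC.rpow_natCast _ 2 (CFC.abs_nonneg T)]
      norm_num
    rw [this]
    exact hT.clm_comp (star T)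
  have hsym : (A : H →ₗ[ℂ] H).IsSymmetric := hAs.isSymmetric
  let V : ℂ → Submodule ℂ H := fun μ => Module.End.eigenspace (A : Module.End ℂ H) μ
  have hVc : ∀ μ, CompleteSpace (V μ) := fun μ => by
    have : IsClosed (V μ : Set H) := by
      have : (V μ : Set H) = {x | A x = μ • x} := by
        ext x
        simp [V]
      rw [this]
      exact isClosed_eq (by fun_prop) (by fun_prop)
    exact this.completeSpace_coe
  choose w c hc using fun μ => exists_hilbertBasis ℂ (V μ)
  have horth : Orthonormal ℂ fun a : (Σ μ, w μ) => ((c a.1 a.2 : V a.1) : H) :=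
    hsym.orthogonalFamily_eigenspaces.orthonormal_sigma_orthonormal
      (v_family := fun μ => c μ) fun μ => (c μ).orthonormal
  have hspan : (Submodule.span ℂ (Set.range fun a : (Σ μ, w μ) => ((c a.1 a.2 : V a.1) : H)))ᗮ
      = ⊥ := by
    rw [eq_bot_iff, ← ContinuousLinearMap.orthogonalComplement_iSup_eigenspaces_eq_bot hAc hsym]
    intro x hx
    rw [Submodule.mem_orthogonal'] at hx ⊢
    have hx' : ∀ μ, V μ ≤ LinearMap.ker (innerSL ℂ x : H →ₗ[ℂ] ℂ) := fun μ y hy => by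
      have h1 := ((innerSL ℂ x) ∘L (V μ).subtypeL).hasSum ((c μ).hasSum_repr ⟨y, hy⟩)
      have h2 : ∀ i, ⟪x, ((c μ i : V μ) : H)⟫_ℂ = 0 := fun i =>
        hx _ (Submodule.subset_span ⟨⟨μ, i⟩, rfl⟩)
      have h3 : HasSum (fun _ : w μ => (0 : ℂ)) ⟪x, y⟫_ℂ := by
        simpa [h2, inner_smul_right] using h1
      simpa using (h3.unique hasSum_zero)
    intro y hy
    simpa using (iSup_le hx') hy
  let b := HilbertBasis.mkOfOrthogonalEqBot horth hspan
  have hb : ∀ a : (Σ μ, w μ), b a = ((c a.1 a.2 : V a.1) : H) := fun a => by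
    simp [b]
  have hAb : ∀ a : (Σ μ, w μ), A (b a) = a.1 • b a := fun a => by
    rw [hb]
    exact Module.End.mem_eigenspace_iff.1 (c a.1 a.2).2
  have hre : ∀ a : (Σ μ, w μ), ((a.1.re.toNNReal : ℝ) : ℂ) = a.1 := fun a => by
    have h0 := (ContinuousLinearMap.isPositive_iff_complex A).1
      ((ContinuousLinearMap.nonneg_iff_isPositive A).1 hA0) (b a)
    have h2 : ⟪b a, b a⟫_ℂ = 1 := by
      rw [inner_self_eq_norm_sq_to_K, b.orthonormal.1 a]; simp
    rw [hAb, inner_smul_left, h2, mul_one] at h0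
    have h3 : 0 ≤ a.1.re := by simpa using h0.2
    rw [Real.coe_toNNReal _ h3]
    have h4 := congrArg (starRingEnd ℂ) h0.1
    simpa using h4
  exact ⟨_, b, fun a : (Σ μ, w μ) => a.1.re.toNNReal, fun a => by rw [hre, hAb]⟩

/-- A singular value decomposition `T bₖ = sₖ vₖ` of a compact operator. -/
theorem exists_svd {T : H →L[ℂ] H} (hT : IsCompactOperator T) :
    ∃ (ι : Type u) (b : HilbertBasis ι ℂ H) (s : ι → ℝ≥0) (v : ι → H), IsBessel v ∧
      (∀ k, T (b k) = ((s k : ℝ) : ℂ) • v k) ∧ (∀ k, s k ≠ 0 → ⟪v k, v k⟫_ℂ = 1) ∧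
      ∀ p : ℝ, 0 < p → schattenTrace p T = ∑' k, (s k : ℝ≥0∞) ^ p := by
  classical
  obtain ⟨ι, b, s, hs⟩ := exists_hilbertBasis_abs hT
  have hinner : ∀ k l, ⟪T (b k), T (b l)⟫_ℂ = if k = l then ((s k : ℝ) : ℂ) ^ 2 else 0 :=
    fun k l => by
      have h1 : ⟪T (b k), T (b l)⟫_ℂ = ⟪b k, (CFC.abs T * CFC.abs T) (b l)⟫_ℂ := by
        rw [CFC.abs_mul_abs, mul_apply_eq_comp, ContinuousLinearMap.star_eq_adjoint,
          ContinuousLinearMap.adjoint_inner_right]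
      have h2 := b.orthonormal
      rw [orthonormal_iff_ite] at h2
      rw [h1, mul_apply_eq_comp, hs, map_smul, hs, smul_smul, inner_smul_right, h2]
      split_ifs with h
      · rw [h]; ring
      · simp
  let v : ι → H := fun k => ((s k : ℝ) : ℂ)⁻¹ • T (b k)
  have hv1 : ∀ k, s k ≠ 0 → ⟪v k, v k⟫_ℂ = 1 := fun k hk => by
    have : ((s k : ℝ) : ℂ) ≠ 0 := by simpa using hk
    simp only [v, inner_smul_left, inner_smul_right, hinner, if_true, map_inv₀, Complex.conj_ofReal]
    field_simp
  have hv0 : ∀ k, s k = 0 → v k = 0 := fun k hk => by simp [v, hk]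
  refine ⟨ι, b, s, v, fun x => ?_, fun k => ?_, hv1, fun p hp => ?_⟩
  · have ho : Orthonormal ℂ fun k : {k // s k ≠ 0} => v k := by
      rw [orthonormal_iff_ite]
      intro k l
      split_ifs with h
      · rw [h]; exact hv1 _ l.2
      · have : (k : ι) ≠ l := fun h' => h (Subtype.ext h')
        simp only [v, inner_smul_left, inner_smul_right, hinner, if_neg this, mul_zero]
    have h1 := isBessel_of_orthonormal ho x
    have h2 : ∑' k : {k // s k ≠ 0}, ‖⟪v k, x⟫_ℂ‖ₑ ^ 2 = ∑' k, ‖⟪v k, x⟫_ℂ‖ₑ ^ 2 := by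
      refine tsum_subtype_eq_of_support_subset (s := {k | s k ≠ 0})
        (f := fun k => ‖⟪v k, x⟫_ℂ‖ₑ ^ 2) fun k hk => ?_
      intro h0
      apply hk
      simp [hv0 k h0]
    rwa [h2] at h1
  · by_cases hk : s k = 0
    · have := hinner k k
      rw [if_pos rfl, hk] at this
      simp only [hk, NNReal.coe_zero, Complex.ofReal_zero, zero_smul]
      exact inner_self_eq_zero (𝕜 := ℂ).1 (by simpa using this)
    · have : ((s k : ℝ) : ℂ) ≠ 0 := by simpa using hk
      simp [v, smul_smul, this]
  · rw [schattenTrace, posTrace_eq b CFC.rpow_nonneg]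
    refine tsum_congr fun k => ?_
    have hA0 : 0 ≤ CFC.abs T := CFC.abs_nonneg T
    have h1 : (CFC.abs T ^ p) (b k) = (((s k : ℝ) ^ p : ℝ) : ℂ) • b k := by
      rw [CFC.rpow_eq_cfc_real hA0]
      exact cfc_apply_eigenvector hA0.isSelfAdjoint
        (Real.continuous_rpow_const hp.le).continuousOn (hs k)
    have h2 : ⟪b k, b k⟫_ℂ = 1 := by
      rw [inner_self_eq_norm_sq_to_K, b.orthonormal.1 k]; simp
    rw [h1, inner_smul_right, h2, mul_one]
    change ENNReal.ofReal ((s k : ℝ) ^ p) = _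
    rw [← ENNReal.ofReal_rpow_of_nonneg (s k).coe_nonneg hp.le, ENNReal.ofReal_coe_nnreal]

theorem IsBessel.enorm_le_one {ι : Type*} {e : ι → H} (he : IsBessel e) (i : ι) : ‖e i‖ₑ ≤ 1 := by
  have h := (ENNReal.le_tsum i).trans (he (e i))
  have h2 : ‖⟪e i, e i⟫_ℂ‖ₑ = ‖e i‖ₑ ^ 2 := by
    rw [inner_self_eq_norm_sq_to_K]
    simp [enorm]
  rw [h2] at h
  by_contra! hlt
  have h3 : 1 < ‖e i‖ₑ ^ 2 := one_lt_pow₀ hlt two_ne_zero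
  have h4 : ‖e i‖ₑ ^ 2 ≠ ⊤ := by simp
  have h5 : ‖e i‖ₑ ^ 2 * 1 < ‖e i‖ₑ ^ 2 * ‖e i‖ₑ ^ 2 :=
    ENNReal.mul_lt_mul_right (zero_lt_one.trans h3).ne' h4 h3
  rw [mul_one, ← sq] at h5
  exact absurd h h5.not_ge

theorem IsBessel.const_smul_adjoint {ι : Type*} {e : ι → H} (he : IsBessel e) (A : H →L[ℂ] H)
    (hA : ‖A‖ ≤ 1) : IsBessel fun i => ContinuousLinearMap.adjoint A (e i) := fun x => by
  simp_rw [ContinuousLinearMap.adjoint_inner_left]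
  refine (he (A x)).trans ?_
  gcongr
  rw [← ofReal_norm, ← ofReal_norm]
  exact ENNReal.ofReal_le_ofReal ((A.le_opNorm x).trans (by nlinarith [norm_nonneg x]))

theorem tsum_mul_le_one {ι : Type*} (a c : ι → ℝ≥0∞) (ha : ∑' i, a i ^ 2 ≤ 1)
    (hc : ∑' i, c i ^ 2 ≤ 1) : ∑' i, a i * c i ≤ 1 := by
  have h : ∀ x y : ℝ≥0∞, 2 * (x * y) ≤ x ^ 2 + y ^ 2 := fun x y => by
    induction x using ENNReal.recTopCoe with
    | top => simp
    | coe x =>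
      induction y using ENNReal.recTopCoe with
      | top => simp
      | coe y =>
        norm_cast
        rw [← NNReal.coe_le_coe]
        push_cast
        nlinarith [sq_nonneg ((x : ℝ) - y)]
  have h2 : 2 * ∑' i, a i * c i ≤ 2 * 1 := by
    rw [← ENNReal.tsum_mul_left]
    refine (ENNReal.tsum_le_tsum fun i => h _ _).trans ?_
    rw [ENNReal.tsum_add, mul_one]
    exact (add_le_add ha hc).trans_eq one_add_one_eq_two
  exact (ENNReal.mul_le_mul_iff_right two_ne_zero ENNReal.ofNat_ne_top).1 h2

theorem tsum_weight_rpow_le {ι : Type*} {p : ℝ} (hp : 1 ≤ p) (w f : ι → ℝ≥0∞)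
    (hw : ∑' i, w i ≤ 1) : (∑' i, w i * f i) ^ p ≤ ∑' i, w i * f i ^ p := by
  have hp0 : 0 < p := zero_lt_one.trans_le hp
  have h : ∑' i, w i * f i ≤ (∑' i, w i * f i ^ p) ^ p⁻¹ := by
    refine ENNReal.summable.tsum_le_of_sum_le fun s => ?_
    refine (ENNReal.inner_le_weight_mul_Lp_of_nonneg s hp w f).trans ?_
    calc _ ≤ (1 : ℝ≥0∞) * (∑' i, w i * f i ^ p) ^ p⁻¹ := by
          gcongr
          · exact ENNReal.rpow_le_one ((ENNReal.sum_le_tsum s).trans hw)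
              (sub_nonneg.2 (inv_le_one_of_one_le₀ hp))
          · exact ENNReal.sum_le_tsum s
      _ = _ := one_mul _
  calc _ ≤ ((∑' i, w i * f i ^ p) ^ p⁻¹) ^ p := ENNReal.rpow_le_rpow h hp0.le
    _ = _ := by rw [← ENNReal.rpow_mul, inv_mul_cancel₀ hp0.ne', ENNReal.rpow_one]

/-- `∑ |⟨fᵢ, T eᵢ⟩|^p ≤ Tr(|T|^p)`. -/
theorem tsum_inner_rpow_le {p : ℝ} (hp : 1 ≤ p) {T : H →L[ℂ] H} (hT : IsCompactOperator T)
    {κ : Type*} {e f : κ → H} (he : IsBessel e) (hf : IsBessel f) :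
    ∑' i, ‖⟪f i, T (e i)⟫_ℂ‖ₑ ^ p ≤ schattenTrace p T := by
  obtain ⟨ι, b, s, v, hv, hTb, -, htr⟩ := exists_svd hT
  have hp0 : 0 < p := zero_lt_one.trans_le hp
  rw [htr p hp0]
  let d : κ → ι → ℝ≥0∞ := fun i k => ‖⟪b k, e i⟫_ℂ‖ₑ * ‖⟪f i, v k⟫_ℂ‖ₑ
  have hd1 : ∀ i, ∑' k, d i k ≤ 1 := fun i => by
    refine tsum_mul_le_one _ _ ?_ ?_
    · rw [hilbertBasis_tsum_enorm_sq]
      exact pow_le_one₀ zero_le (he.enorm_le_one i)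
    · simp_rw [← inner_conj_symm (f i), RCLike.enorm_conj]
      exact (hv _).trans (pow_le_one₀ zero_le (hf.enorm_le_one i))
  have hd2 : ∀ k, ∑' i, d i k ≤ 1 := fun k => by
    refine tsum_mul_le_one _ _ ?_ ?_
    · simp_rw [← inner_conj_symm (b k), RCLike.enorm_conj]
      refine (he _).trans (pow_le_one₀ zero_le ?_)
      exact (isBessel_of_orthonormal b.orthonormal).enorm_le_one k
    · exact (hf _).trans (pow_le_one₀ zero_le (hv.enorm_le_one k))
  have hle : ∀ i, ‖⟪f i, T (e i)⟫_ℂ‖ₑ ≤ ∑' k, d i k * s k := fun i => by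
    have h1 := ((innerSL ℂ (f i)) ∘L T).hasSum (b.hasSum_repr (e i))
    have h2 : HasSum (fun k => ⟪b k, e i⟫_ℂ * (((s k : ℝ) : ℂ) * ⟪f i, v k⟫_ℂ)) ⟪f i, T (e i)⟫_ℂ := by
      simpa [hTb, inner_smul_right, b.repr_apply_apply] using h1
    rw [← h2.tsum_eq]
    refine enorm_tsum_le_tsum_enorm.trans (ENNReal.tsum_le_tsum fun k => ?_)
    have : ‖((s k : ℝ) : ℂ)‖ₑ = s k := by simp [enorm]
    rw [enorm_mul, enorm_mul, this, mul_comm (s k : ℝ≥0∞), ← mul_assoc]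
  calc ∑' i, ‖⟪f i, T (e i)⟫_ℂ‖ₑ ^ p ≤ ∑' i, ∑' k, d i k * (s k : ℝ≥0∞) ^ p :=
        ENNReal.tsum_le_tsum fun i =>
          (ENNReal.rpow_le_rpow (hle i) hp0.le).trans (tsum_weight_rpow_le hp _ _ (hd1 i))
    _ = ∑' k, (∑' i, d i k) * (s k : ℝ≥0∞) ^ p := by
        rw [ENNReal.tsum_comm]
        simp_rw [ENNReal.tsum_mul_right]
    _ ≤ ∑' k, 1 * (s k : ℝ≥0∞) ^ p := by
        refine ENNReal.tsum_le_tsum fun k => ?_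
        gcongr
        exact hd2 k
    _ = _ := by simp

theorem exists_schattenTrace_eq {T : H →L[ℂ] H} (hT : IsCompactOperator T) :
    ∃ (ι : Type u) (e f : ι → H), IsBessel e ∧ IsBessel f ∧
      ∀ p : ℝ, 0 < p → schattenTrace p T = ∑' i, ‖⟪f i, T (e i)⟫_ℂ‖ₑ ^ p := by
  obtain ⟨ι, b, s, v, hv, hTb, hv1, htr⟩ := exists_svd hT
  refine ⟨ι, b, v, isBessel_of_orthonormal b.orthonormal, hv, fun p hp => ?_⟩
  rw [htr p hp]
  refine tsum_congr fun k => ?_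
  rw [hTb, inner_smul_right]
  by_cases hk : s k = 0
  · simp [hk]
  · rw [hv1 k hk, mul_one]
    congr 1
    simp [enorm]

theorem isCompactOperator_of_schattenTrace {p : ℝ} (hp : 0 < p) {T : H →L[ℂ] H}
    (hT : schattenTrace p T ≠ ⊤) : IsCompactOperator T := by
  obtain ⟨w, b, -⟩ := exists_hilbertBasis ℂ H
  refine isCompactOperator_of_abs_rpow T (half_pos hp) (isCompactOperator_of_tsum_enorm_sq b _ ?_)
  have hsa : IsSelfAdjoint (CFC.abs T ^ (p / 2)) :=
    (CFC.rpow_nonneg (a := CFC.abs T) (y := p / 2)).isSelfAdjoint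
  simp_rw [← ofReal_inner_sq _ hsa]
  have : CFC.abs T ^ (p / 2) * CFC.abs T ^ (p / 2) = CFC.abs T ^ p := by
    have hA0 : 0 ≤ CFC.abs T := CFC.abs_nonneg T
    have hc : Continuous fun t : ℝ => t ^ (p / 2) := Real.continuous_rpow_const (half_pos hp).le
    rw [CFC.rpow_eq_cfc_real hA0, CFC.rpow_eq_cfc_real hA0,
      ← cfc_mul _ _ _ hc.continuousOn hc.continuousOn]
    refine cfc_congr fun t ht => ?_
    have ht0 : 0 ≤ t := spectrum_nonneg_of_nonneg hA0 ht
    change t ^ (p / 2) * t ^ (p / 2) = t ^ p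
    rw [← Real.rpow_add_of_nonneg ht0 (half_pos hp).le (half_pos hp).le, add_halves]
  rw [this, ← posTrace_eq b CFC.rpow_nonneg]
  exact hT

/-- The Schatten norm `‖T‖_p = Tr(|T|^p)^(1/p)`, with values in `[0, ∞]`. -/
def schattenENorm (p : ℝ) (T : H →L[ℂ] H) : ℝ≥0∞ := schattenTrace p T ^ (1 / p)

theorem isCompactOperator_of_schattenENorm {p : ℝ} (hp : 0 < p) {T : H →L[ℂ] H}
    (hT : schattenENorm p T ≠ ⊤) : IsCompactOperator T := by
  refine isCompactOperator_of_schattenTrace hp fun h => hT ?_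
  rw [schattenENorm, h, ENNReal.top_rpow_of_pos (by positivity)]

theorem schattenENorm_zero {p : ℝ} (hp : 0 < p) : schattenENorm p (0 : H →L[ℂ] H) = 0 := by
  obtain ⟨ι, e, f, -, -, h⟩ := exists_schattenTrace_eq (H := H) (T := 0) isCompactOperator_zero
  rw [schattenENorm, h p hp]
  simp [hp]

theorem schattenENorm_add_le {p : ℝ} (hp : 1 ≤ p) (S T : H →L[ℂ] H) :
    schattenENorm p (S + T) ≤ schattenENorm p S + schattenENorm p T := by
  have hp0 : 0 < p := zero_lt_one.trans_le hp
  by_cases hS : schattenENorm p S = ⊤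
  · simp [hS]
  by_cases hT : schattenENorm p T = ⊤
  · simp [hT]
  have hSc := isCompactOperator_of_schattenENorm hp0 hS
  have hTc := isCompactOperator_of_schattenENorm hp0 hT
  obtain ⟨ι, e, f, he, hf, h⟩ := exists_schattenTrace_eq (T := S + T) (hSc.add hTc)
  have key : schattenTrace p (S + T) ≤ (schattenENorm p S + schattenENorm p T) ^ p := by
    rw [h p hp0]
    refine ENNReal.summable.tsum_le_of_sum_le fun s => ?_
    have h1 : (∑ i ∈ s, ‖⟪f i, (S + T) (e i)⟫_ℂ‖ₑ ^ p) ^ (1 / p) ≤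
        schattenENorm p S + schattenENorm p T := by
      calc _ ≤ (∑ i ∈ s, (‖⟪f i, S (e i)⟫_ℂ‖ₑ + ‖⟪f i, T (e i)⟫_ℂ‖ₑ) ^ p) ^ (1 / p) := by
            gcongr with i hi
            rw [add_apply, inner_add_right]
            exact enorm_add_le _ _
        _ ≤ _ := ENNReal.Lp_add_le s _ _ hp
        _ ≤ _ := by
            unfold schattenENorm
            gcongr
            · exact (ENNReal.sum_le_tsum s).trans (tsum_inner_rpow_le hp hSc he hf)
            · exact (ENNReal.sum_le_tsum s).trans (tsum_inner_rpow_le hp hTc he hf)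
    have h2 := ENNReal.rpow_le_rpow h1 hp0.le
    rwa [← ENNReal.rpow_mul, one_div_mul_cancel hp0.ne', ENNReal.rpow_one] at h2
  have h2 := ENNReal.rpow_le_rpow key (one_div_pos.2 hp0).le
  rwa [← ENNReal.rpow_mul, mul_one_div_cancel hp0.ne', ENNReal.rpow_one] at h2

theorem schattenENorm_smul_le {p : ℝ} (hp : 1 ≤ p) (c : ℂ) {T : H →L[ℂ] H}
    (hT : schattenENorm p T ≠ ⊤) : schattenENorm p (c • T) ≤ ‖c‖ₑ * schattenENorm p T := by
  have hp0 : 0 < p := zero_lt_one.trans_le hp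
  have hTc := isCompactOperator_of_schattenENorm hp0 hT
  obtain ⟨ι, e, f, he, hf, h⟩ := exists_schattenTrace_eq (T := c • T) (hTc.smul c)
  have key : schattenTrace p (c • T) ≤ ‖c‖ₑ ^ p * schattenTrace p T := by
    rw [h p hp0]
    simp_rw [smul_apply, inner_smul_right, enorm_mul, ENNReal.mul_rpow_of_nonneg _ _ hp0.le,
      ENNReal.tsum_mul_left]
    gcongr
    exact tsum_inner_rpow_le hp hTc he hf
  have h2 := ENNReal.rpow_le_rpow key (one_div_pos.2 hp0).le
  rwa [ENNReal.mul_rpow_of_nonneg _ _ (one_div_pos.2 hp0).le, ← ENNReal.rpow_mul,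
    mul_one_div_cancel hp0.ne', ENNReal.rpow_one] at h2

theorem schattenENorm_mul_le_of_norm_le_one {p : ℝ} (hp : 1 ≤ p) (A : H →L[ℂ] H) (hA : ‖A‖ ≤ 1)
    {T : H →L[ℂ] H} (hT : schattenENorm p T ≠ ⊤) :
    schattenENorm p (A * T) ≤ schattenENorm p T := by
  have hp0 : 0 < p := zero_lt_one.trans_le hp
  have hTc := isCompactOperator_of_schattenENorm hp0 hT
  obtain ⟨ι, e, f, he, hf, h⟩ := exists_schattenTrace_eq (T := A * T) (hTc.clm_comp A)
  refine ENNReal.rpow_le_rpow ?_ (one_div_pos.2 hp0).le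
  rw [h p hp0]
  have h1 : ∀ i, ⟪f i, (A * T) (e i)⟫_ℂ =
      ⟪ContinuousLinearMap.adjoint A (f i), T (e i)⟫_ℂ := fun i => by
    rw [mul_apply_eq_comp, ContinuousLinearMap.adjoint_inner_left]
  simp_rw [h1]
  exact tsum_inner_rpow_le hp hTc he (hf.const_smul_adjoint A hA)

theorem schattenENorm_mul_le_enorm {p : ℝ} (hp : 1 ≤ p) (A : H →L[ℂ] H) {T : H →L[ℂ] H}
    (hT : schattenENorm p T ≠ ⊤) : schattenENorm p (A * T) ≤ ‖A‖ₑ * schattenENorm p T := by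
  by_cases hA : A = 0
  · simp [hA, schattenENorm_zero (zero_lt_one.trans_le hp)]
  have hA' : (‖A‖ : ℂ) ≠ 0 := by simpa using hA
  have h1 : A * T = (‖A‖ : ℂ) • (((‖A‖ : ℂ)⁻¹ • A) * T) := by
    rw [smul_mul_assoc, smul_smul, mul_inv_cancel₀ hA', one_smul]
  have hn : ‖(‖A‖ : ℂ)⁻¹ • A‖ ≤ 1 := by
    rw [norm_smul, norm_inv, Complex.norm_real, norm_norm, inv_mul_cancel₀ (by simpa using hA)]
  have h2 := schattenENorm_mul_le_of_norm_le_one hp _ hn hT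
  rw [h1]
  refine (schattenENorm_smul_le hp _ (ne_top_of_le_ne_top hT h2)).trans ?_
  have : ‖(‖A‖ : ℂ)‖ₑ = ‖A‖ₑ := by simp [enorm]
  rw [this]
  gcongr

theorem enorm_le_schattenENorm {p : ℝ} (hp : 1 ≤ p) (T : H →L[ℂ] H) :
    ‖T‖ₑ ≤ schattenENorm p T := by
  have hp0 : 0 < p := zero_lt_one.trans_le hp
  by_cases hT : schattenENorm p T = ⊤
  · simp [hT]
  have hTc := isCompactOperator_of_schattenENorm hp0 hT
  have hunit : ∀ x : H, ‖x‖ = 1 → IsBessel fun _ : Unit => x := fun x hx =>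
    isBessel_of_orthonormal ⟨fun _ => hx, fun i j hij => (hij rfl).elim⟩
  have key : ∀ x : H, ‖x‖ = 1 → ‖T x‖ₑ ≤ schattenENorm p T := fun x hx => by
    by_cases h0 : T x = 0
    · simp [h0]
    have hy : ‖(‖T x‖ : ℂ)⁻¹ • T x‖ = 1 := by
      rw [norm_smul, norm_inv, Complex.norm_real, norm_norm, inv_mul_cancel₀ (by simpa using h0)]
    have h1 := tsum_inner_rpow_le hp hTc (hunit x hx) (hunit _ hy)
    have h2 : ‖⟪(‖T x‖ : ℂ)⁻¹ • T x, T x⟫_ℂ‖ₑ = ‖T x‖ₑ := by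
      rw [inner_smul_left, inner_self_eq_norm_sq_to_K, map_inv₀, Complex.conj_ofReal]
      have : (‖T x‖ : ℂ) ≠ 0 := by simpa using h0
      have h3 : (‖T x‖ : ℂ)⁻¹ * ((‖T x‖ : ℝ) : ℂ) ^ 2 = (‖T x‖ : ℂ) := by field_simp
      refine (congrArg _ h3).trans ?_
      simp [enorm]
    simp only [h2, tsum_fintype, Finset.univ_unique, Finset.sum_const, Finset.card_singleton,
      one_smul] at h1
    have h4 := ENNReal.rpow_le_rpow h1 (one_div_pos.2 hp0).le
    rwa [← ENNReal.rpow_mul, mul_one_div_cancel hp0.ne', ENNReal.rpow_one] at h4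
  have hreal : ‖T‖ ≤ (schattenENorm p T).toReal := by
    refine ContinuousLinearMap.opNorm_le_of_unit_norm ENNReal.toReal_nonneg fun x hx => ?_
    have := ENNReal.toReal_mono hT (key x hx)
    simpa using this
  rw [← ofReal_norm]
  exact (ENNReal.ofReal_le_ofReal hreal).trans ENNReal.ofReal_toReal_le

theorem schattenENorm_mul_le {p : ℝ} (hp : 1 ≤ p) {S T : H →L[ℂ] H} (hT : schattenENorm p T ≠ ⊤) :
    schattenENorm p (S * T) ≤ schattenENorm p S * schattenENorm p T :=
  (schattenENorm_mul_le_enorm hp S hT).trans (by gcongr; exact enorm_le_schattenENorm hp S)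

variable (p : ℝ) [hp : Fact (1 ≤ p)]

variable (H) in
/-- The operators `T` on `H` with `‖T‖_p < ∞`, as a subalgebra of `B(H)`. -/
def schattenSubalgebra : NonUnitalSubalgebra ℂ (H →L[ℂ] H) where
  carrier := {T | schattenENorm p T < ⊤}
  zero_mem' := by
    simp [schattenENorm_zero (H := H) (zero_lt_one.trans_le hp.out)]
  add_mem' {S T} hS hT :=
    (schattenENorm_add_le hp.out S T).trans_lt (ENNReal.add_lt_top.2 ⟨hS, hT⟩)
  smul_mem' c T hT := (schattenENorm_smul_le hp.out c (ne_of_lt hT)).trans_lt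
    (ENNReal.mul_lt_top enorm_lt_top hT)
  mul_mem' {S T} hS hT := (schattenENorm_mul_le hp.out (ne_of_lt hT)).trans_lt
    (ENNReal.mul_lt_top hS hT)

variable (H) in
/-- The algebra `S_p(H)` of Schatten `p`-class operators, which carries the norm `‖·‖_p`
(and not the operator norm). -/
def SchattenClass : Type u := schattenSubalgebra H p

namespace SchattenClass

instance : NonUnitalRing (SchattenClass H p) :=
  inferInstanceAs (NonUnitalRing (schattenSubalgebra H p))
instance : Module ℂ (SchattenClass H p) :=
  inferInstanceAs (Module ℂ (schattenSubalgebra H p))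
instance : IsScalarTower ℂ (SchattenClass H p) (SchattenClass H p) :=
  inferInstanceAs (IsScalarTower ℂ (schattenSubalgebra H p) (schattenSubalgebra H p))
instance : SMulCommClass ℂ (SchattenClass H p) (SchattenClass H p) :=
  inferInstanceAs (SMulCommClass ℂ (schattenSubalgebra H p) (schattenSubalgebra H p))

variable {p}

/-- The underlying operator of an element of `S_p(H)`. -/
def toOp (T : SchattenClass H p) : H →L[ℂ] H := (show schattenSubalgebra H p from T).1

theorem toOp_injective : Function.Injective (toOp : SchattenClass H p → (H →L[ℂ] H)) :=
  Subtype.val_injective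

theorem toOp_zero : toOp (0 : SchattenClass H p) = 0 := rfl
theorem toOp_add (S T : SchattenClass H p) : toOp (S + T) = toOp S + toOp T := rfl
theorem toOp_mul (S T : SchattenClass H p) : toOp (S * T) = toOp S * toOp T := rfl
theorem toOp_smul (c : ℂ) (T : SchattenClass H p) : toOp (c • T) = c • toOp T := rfl

theorem schattenENorm_ne_top (T : SchattenClass H p) : schattenENorm p (toOp T) ≠ ⊤ :=
  ne_of_lt (show schattenSubalgebra H p from T).2

/-- The norm of `S_p(H)`. -/
def snorm (T : SchattenClass H p) : ℝ := (schattenENorm p (toOp T)).toReal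

theorem snorm_smul_le (c : ℂ) (T : SchattenClass H p) : snorm (c • T) ≤ ‖c‖ * snorm T := by
  have h := schattenENorm_smul_le hp.out c (schattenENorm_ne_top T)
  have := ENNReal.toReal_mono (ENNReal.mul_ne_top enorm_ne_top (schattenENorm_ne_top T)) h
  simpa [snorm, toOp_smul] using this

theorem snorm_add_le (S T : SchattenClass H p) : snorm (S + T) ≤ snorm S + snorm T := by
  have h := ENNReal.toReal_mono
    (ENNReal.add_ne_top.2 ⟨schattenENorm_ne_top S, schattenENorm_ne_top T⟩)
    (schattenENorm_add_le hp.out (toOp S) (toOp T))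
  rwa [ENNReal.toReal_add (schattenENorm_ne_top S) (schattenENorm_ne_top T)] at h

theorem snorm_neg (T : SchattenClass H p) : snorm (-T) = snorm T := by
  have h : ∀ T : SchattenClass H p, snorm (-T) ≤ snorm T := fun T => by
    simpa using snorm_smul_le (-1) T
  exact le_antisymm (h T) (by simpa using h (-T))

theorem norm_toOp_le (T : SchattenClass H p) : ‖toOp T‖ ≤ snorm T := by
  simpa [snorm] using ENNReal.toReal_mono (schattenENorm_ne_top T) (enorm_le_schattenENorm hp.out (toOp T))

instance : NonUnitalNormedRing (SchattenClass H p) :=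
  { AddGroupNorm.toNormedAddCommGroup (E := SchattenClass H p)
      { toFun := snorm
        map_zero' := by
          simp [snorm, toOp_zero, schattenENorm_zero (H := H) (zero_lt_one.trans_le hp.out)]
        add_le' := snorm_add_le
        neg' := snorm_neg
        eq_zero_of_map_eq_zero' := fun T hT => toOp_injective <| by
          have := norm_toOp_le T
          rw [hT] at this
          exact norm_le_zero_iff.1 this },
    (inferInstance : NonUnitalRing (SchattenClass H p)) with
    norm_mul_le := fun S T => by
      have h := ENNReal.toReal_mono
        (ENNReal.mul_ne_top (schattenENorm_ne_top S) (schattenENorm_ne_top T))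
        (schattenENorm_mul_le hp.out (S := toOp S) (schattenENorm_ne_top T))
      rwa [ENNReal.toReal_mul] at h }

theorem norm_def (T : SchattenClass H p) : ‖T‖ = (schattenENorm p (toOp T)).toReal := rfl

instance : NormedSpace ℂ (SchattenClass H p) where
  norm_smul_le := snorm_smul_le

end SchattenClass

end Schatten

instance factOneLeTwoReal : Fact ((1 : ℝ) ≤ 2) := ⟨one_le_two⟩

/-- The Hilbert-Schmidt operators `S_2(H)`. -/
abbrev HilbertSchmidt (H : Type*) [NormedAddCommGroup H] [InnerProductSpace ℂ H]
    [CompleteSpace H] : Type _ := SchattenClass H 2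

/-- The algebra `B₀(K)` of compact operators on `K`, a subalgebra of `B(K)` with its norm. -/
def compactOperators (K : Type*) [NormedAddCommGroup K] [NormedSpace ℂ K] :
    NonUnitalSubalgebra ℂ (K →L[ℂ] K) where
  carrier := {T | IsCompactOperator T}
  zero_mem' := isCompactOperator_zero
  add_mem' ha hb := ha.add hb
  smul_mem' c _ h := h.smul c
  mul_mem' {_ b} ha _ := ha.comp_clm b

instance (K : Type*) [NormedAddCommGroup K] [NormedSpace ℂ K] :
    NormedSpace ℂ (compactOperators K) where
  norm_smul_le c T := norm_smul_le c (T : K →L[ℂ] K)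

end

/-! ### Iterated limits and the two Arens products. -/

open Filter Topology

/-! Arens regularity fails as soon as one functional `ω` and two bounded sequences `u m`, `v n` have
different iterated limits of `ω (u m * v n)`. If `f` and `g` are weak-* limits of the two sequences
in the bidual along a free ultrafilter, then the first Arens product takes the limit over `n` before
the limit over `m`, and the second takes them in the opposite order. So it is enough to realise the
matrix that is `1` for `m < n` and `0` otherwise (`not_arensRegular_of_iterated_limits`). On a
projective tensor product the functional may come from any bounded bilinear form, and elementary
tensors multiply factor by factor (`ProjTensor.not_arensRegular`).

To realise this matrix, fix an orthonormal sequence `e` and write `E i j` for the matrix unit `x ↦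
⟪e j, x⟫ • e i`. Since `p ≤ 2`, an element `S` of `S_p` is also a vector of `S_2`, so an operator
`T` on `S_2` can be applied to it; the form is `(T, S) ↦ ⟪e 0, (T S) (e 0)⟫`. Take `u m` with second
factor `E m 0` and `v n` with second factor `E 0 n`, whose product is `E m n`. The first factor of
`v n` reads only column `n`, cuts it off to the rows `k < n` and moves it to column `0`, so it sends
`E m n` to `E m 0` if `m < n` and to `0` otherwise. The first factor of `u m` then moves `E m 0` to
`E 0 0`, where the form has the value `1`.

The order relation costs nothing in norm because each operator truncates a single column: on all of
`S_2` it is `S ↦ P S (E n 0)`, with `P` the projection onto the span of the `e k`, `k < n`, hence a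
contraction (`norm_columnShift_le`). All the operators involved have finite rank, so the same
sequences serve for the compact operators. -/

/-- A bounded sequence has a limit point in the bidual, along a fixed ultrafilter. -/
theorem exists_bidual_limit {E : Type*} [SeminormedAddCommGroup E] [NormedSpace ℂ E]
    (l : Ultrafilter ℕ) {u : ℕ → E} {C : ℝ} (hu : ∀ n, ‖u n‖ ≤ C) :
    ∃ f : StrongDual ℂ (StrongDual ℂ E),
      ∀ φ : StrongDual ℂ E, Tendsto (fun n => φ (u n)) l (𝓝 (f φ)) := by
  have hle : ∀ (φ : StrongDual ℂ E) n, ‖φ (u n)‖ ≤ C * ‖φ‖ := fun φ n => by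
    rw [mul_comm]
    exact (φ.le_opNorm _).trans (mul_le_mul_of_nonneg_left (hu n) (norm_nonneg _))
  have hlim : ∀ φ : StrongDual ℂ E, ∃ z : ℂ, Tendsto (fun n => φ (u n)) l (𝓝 z) := fun φ => by
    -- The scalars `φ (u n)` lie in a closed disc, and an ultrafilter on a compact set converges.
    obtain ⟨z, -, hz⟩ := (isCompact_closedBall (0 : ℂ) (C * ‖φ‖)).ultrafilter_le_nhds'
      (l.map fun n => φ (u n)) (Ultrafilter.mem_map.2 (Filter.univ_mem' fun n => by
        simpa using hle φ n))
    exact ⟨z, hz⟩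
  choose F hF using hlim
  -- Linearity follows from uniqueness of limits, and the bound `C` passes to the limit.
  refine ⟨LinearMap.mkContinuous
    { toFun := F
      map_add' := fun φ ψ => tendsto_nhds_unique (hF (φ + ψ)) ((hF φ).add (hF ψ))
      map_smul' := fun c φ => tendsto_nhds_unique (hF (c • φ)) ((hF φ).const_smul c) } C
    fun φ => le_of_tendsto (hF φ).norm (Eventually.of_forall (hle φ)), hF⟩

/-- Different iterated limits of a functional along products of bounded sequences rule out
Arens regularity. -/
theorem not_arensRegular_of_iterated_limits {A : Type*} [NonUnitalSeminormedRing A]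
    [NormedSpace ℂ A] [IsScalarTower ℂ A A] [SMulCommClass ℂ A A] (ω : StrongDual ℂ A)
    {u v : ℕ → A} {C D : ℝ} (hu : ∀ m, ‖u m‖ ≤ C) (hv : ∀ n, ‖v n‖ ≤ D)
    (h : ∀ m n, ω (u m * v n) = if m < n then 1 else 0) : ¬ ArensRegular A := by
  intro hA
  -- A free ultrafilter refines `atTop`, so what holds for all large indices holds along it; this is
  -- what lets the diagonal be crossed in either variable.
  have hl : ((hyperfilter ℕ : Ultrafilter ℕ) : Filter ℕ) ≤ atTop := Nat.hyperfilter_le_atTop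
  obtain ⟨f, hf⟩ := exists_bidual_limit (hyperfilter ℕ) hu
  obtain ⟨g, hg⟩ := exists_bidual_limit (hyperfilter ℕ) hv
  have hg1 : ∀ m, g (arensLeft ω (u m)) = 1 := fun m => by
    refine tendsto_nhds_unique (hg _) (tendsto_const_nhds.congr' ?_)
    filter_upwards [hl (eventually_gt_atTop m)] with n hn
    rw [arensLeft_apply, h, if_pos hn]
  have hf0 : ∀ n, f (arensRight ω (v n)) = 0 := fun n => by
    refine tendsto_nhds_unique (hf _) (tendsto_const_nhds.congr' ?_)
    filter_upwards [hl (eventually_ge_atTop n)] with m hm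
    rw [arensRight_apply, h, if_neg hm.not_gt]
  -- Here `f` is evaluated at the functional `a ↦ g (arensLeft ω a)`, which is constantly `1` on the
  -- sequence `u`; symmetrically below, with the constant `0` on `v`.
  have h1 : arensBox f g ω = 1 := by
    rw [arensBox_apply]
    refine tendsto_nhds_unique (hf _) (tendsto_const_nhds.congr fun m => ?_)
    exact (hg1 m).symm
  have h0 : arensDiamond f g ω = 0 := by
    rw [arensDiamond_apply]
    refine tendsto_nhds_unique (hg _) (tendsto_const_nhds.congr fun n => ?_)
    exact (hf0 n).symm
  rw [hA f g, h0] at h1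
  exact zero_ne_one h1

/-! ### Functionals on the projective tensor product. -/

section Projective

variable {A B : Type*}
  [NonUnitalNormedRing A] [NormedSpace ℂ A] [IsScalarTower ℂ A A] [SMulCommClass ℂ A A]
  [NonUnitalNormedRing B] [NormedSpace ℂ B] [IsScalarTower ℂ B B] [SMulCommClass ℂ B B]

/-- A bounded bilinear form on `A × B` induces a functional on the projective tensor product. -/
theorem ProjTensor.exists_dual_tmul (Φ : A →L[ℂ] B →L[ℂ] ℂ) :
    ∃ ω : StrongDual ℂ (ProjTensor A B),
      ∀ a b, ω (ofAlg A B (AlgTensor.tmul a b)) = Φ a b := by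
  let L : AlgTensor A B →ₗ[ℂ] ℂ :=
    TensorProduct.lift ((ContinuousLinearMap.coeLM ℂ).comp (Φ : A →ₗ[ℂ] B →L[ℂ] ℂ))
  have hL : ∀ a b, L (AlgTensor.tmul a b) = Φ a b := fun a b => TensorProduct.lift.tmul a b
  have hbound : ∀ u, ‖L u‖ ≤ ‖Φ‖ * ‖u‖ := fun u => by
    -- Every representation of `u` as a sum of elementary tensors bounds `L u` by its own cost;
    -- passing to the infimum gives the projective norm.
    have key : ∀ r ∈ AlgTensor.costs u, ‖L u‖ ≤ ‖Φ‖ * r := by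
      rintro r ⟨n, x, y, rfl, rfl⟩
      rw [map_sum, Finset.mul_sum]
      refine norm_sum_le_of_le _ fun i _ => ?_
      rw [hL, ← mul_assoc]
      exact Φ.le_opNorm₂ _ _
    obtain ⟨r, -, hr, hr'⟩ := exists_seq_tendsto_sInf (AlgTensor.costs_nonempty u)
      (AlgTensor.costs_bddBelow u)
    exact ge_of_tendsto' (hr.const_mul ‖Φ‖) fun n => key _ (hr' n)
  refine ⟨(L.mkContinuous ‖Φ‖ hbound).extend (ofAlg A B), fun a b => ?_⟩
  rw [ContinuousLinearMap.extend_eq _ denseRange_ofAlg isUniformInducing_ofAlg]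
  exact hL a b

theorem ProjTensor.norm_ofAlg_tmul_le (a : A) (b : B) :
    ‖ofAlg A B (AlgTensor.tmul a b)‖ ≤ ‖a‖ * ‖b‖ := by
  rw [norm_ofAlg]
  exact AlgTensor.projNorm_le (AlgTensor.costs_tmul_mem a b)

/-- Elementary tensors of contractions lie in the unit ball and multiply componentwise, so the
iterated limit criterion becomes a condition on the bilinear form alone. -/
theorem ProjTensor.not_arensRegular (Φ : A →L[ℂ] B →L[ℂ] ℂ) {a a' : ℕ → A} {b b' : ℕ → B}
    (ha : ∀ n, ‖a n‖ ≤ 1) (ha' : ∀ n, ‖a' n‖ ≤ 1) (hb : ∀ n, ‖b n‖ ≤ 1) (hb' : ∀ n, ‖b' n‖ ≤ 1)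
    (h : ∀ m n, Φ (a m * a' n) (b m * b' n) = if m < n then 1 else 0) :
    ¬ ArensRegular (ProjTensor A B) := by
  obtain ⟨ω, hω⟩ := exists_dual_tmul Φ
  refine not_arensRegular_of_iterated_limits ω (C := 1) (D := 1)
    (u := fun n => ofAlg A B (AlgTensor.tmul (a n) (b n)))
    (v := fun n => ofAlg A B (AlgTensor.tmul (a' n) (b' n)))
    (fun n => (norm_ofAlg_tmul_le _ _).trans (mul_le_one₀ (ha n) (norm_nonneg _) (hb n)))
    (fun n => (norm_ofAlg_tmul_le _ _).trans (mul_le_one₀ (ha' n) (norm_nonneg _) (hb' n)))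
    fun m n => ?_
  rw [← ofAlg_mul, AlgTensor.tmul_mul_tmul, hω, h]

end Projective

/-- The sum is the orthogonal projection onto the span of the `e k`, `k ∈ s`; the bound is Bessel's
inequality. -/
theorem norm_sum_rankOne_le {H : Type*} [NormedAddCommGroup H] [InnerProductSpace ℂ H]
    {e : ℕ → H} (he : Orthonormal ℂ e) (s : Finset ℕ) :
    ‖∑ k ∈ s, (InnerProductSpace.rankOne ℂ (e k) (e k) : H →L[ℂ] H)‖ ≤ 1 := by
  refine ContinuousLinearMap.opNorm_le_bound _ zero_le_one fun x => ?_
  rw [one_mul, sum_apply]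
  simp only [InnerProductSpace.rankOne_apply]
  refine (sq_le_sq₀ (norm_nonneg _) (norm_nonneg _)).1 ?_
  have h := inner_self_eq_norm_sq (𝕜 := ℂ) (∑ k ∈ s, ⟪e k, x⟫_ℂ • e k)
  rw [he.inner_sum] at h
  rw [← h]
  refine le_trans (le_of_eq ?_) (he.sum_inner_products_le x (s := s))
  rw [map_sum]
  refine Finset.sum_congr rfl fun k _ => ?_
  rw [RCLike.conj_mul]
  norm_cast

/-! ### Schatten norms: monotonicity in the exponent and rank-one operators. -/

section Schatten

universe u

variable {H : Type u} [NormedAddCommGroup H] [InnerProductSpace ℂ H] [CompleteSpace H]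

/-- `‖T‖_q ≤ ‖T‖_p` for `p ≤ q`. -/
theorem schattenENorm_anti {p q : ℝ} (hp : 0 < p) (hpq : p ≤ q) (T : H →L[ℂ] H) :
    schattenENorm q T ≤ schattenENorm p T := by
  have hq : 0 < q := hp.trans_le hpq
  by_cases hT : schattenENorm p T = ⊤
  · simp [hT]
  obtain ⟨ι, e, f, -, -, h⟩ := exists_schattenTrace_eq (isCompactOperator_of_schattenENorm hp hT)
  set x : ι → ℝ≥0∞ := fun i => ‖⟪f i, T (e i)⟫_ℂ‖ₑ
  set N := schattenENorm p T with hN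
  have hNp : N ^ p = ∑' i, x i ^ p := by
    rw [hN, schattenENorm, ← ENNReal.rpow_mul, one_div_mul_cancel hp.ne', ENNReal.rpow_one, h p hp]
  -- Each `x i ^ p` is one term of the sum `N ^ p`.
  have hx : ∀ i, x i ≤ N := fun i => by
    rw [← ENNReal.rpow_le_rpow_iff hp, hNp]
    exact ENNReal.le_tsum i
  -- Summing `x i ^ p * x i ^ (q - p)` with the second factor bounded by `N ^ (q - p)` gives `N ^
  -- q`. Both exponents are nonnegative, so the splitting also holds at `0` and `⊤`.
  have hsplit : ∀ y : ℝ≥0∞, y ^ q = y ^ p * y ^ (q - p) := fun y => by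
    rw [← ENNReal.rpow_add_of_nonneg _ _ hp.le (sub_nonneg.2 hpq), add_sub_cancel]
  have key : schattenTrace q T ≤ N ^ q := by
    rw [h q hq, hsplit N, hNp, ← ENNReal.tsum_mul_right]
    refine ENNReal.tsum_le_tsum fun i => ?_
    rw [hsplit]
    gcongr
    exact hx i
  have := ENNReal.rpow_le_rpow key (one_div_pos.2 hq).le
  rwa [← ENNReal.rpow_mul, mul_one_div_cancel hq.ne', ENNReal.rpow_one] at this

/-- The operator `x ↦ ⟨v, x⟩ u` has Schatten norm at most `1` for `‖u‖, ‖v‖ ≤ 1`. -/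
theorem schattenENorm_rankOne_le {p : ℝ} (hp : 1 ≤ p) {u v : H} (hu : ‖u‖ ≤ 1) (hv : ‖v‖ ≤ 1) :
    schattenENorm p (InnerProductSpace.rankOne ℂ u v : H →L[ℂ] H) ≤ 1 := by
  have hp0 : 0 < p := zero_lt_one.trans_le hp
  have hc : IsCompactOperator (InnerProductSpace.rankOne ℂ u v : H →L[ℂ] H) :=
    (isCompactOperator_of_locallyCompactSpace_rng
      (ContinuousLinearMap.toSpanSingleton ℂ u)).comp_clm (innerSL ℂ v)
  obtain ⟨ι, e, f, he, hf, h⟩ := exists_schattenTrace_eq hc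
  have hsq : ∀ {g : ι → H} {w : H}, IsBessel g → ‖w‖ ≤ 1 → ∑' i, ‖⟪g i, w⟫_ℂ‖ₑ ^ 2 ≤ 1 :=
    fun hg hw => (hg _).trans (pow_le_one₀ zero_le (by
      rw [← ofReal_norm]; exact ENNReal.ofReal_le_one.2 hw))
  -- This is the case `p = 1`. It makes every term at most `1`, so raising the terms to a power `p ≥
  -- 1` only decreases them.
  have hsum := tsum_mul_le_one _ _ (hsq he hv) (hsq hf hu)
  have key : schattenTrace p (InnerProductSpace.rankOne ℂ u v : H →L[ℂ] H) ≤ 1 := by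
    rw [h p hp0]
    refine (ENNReal.tsum_le_tsum fun i => ?_).trans hsum
    have h1 : ‖⟪f i, (InnerProductSpace.rankOne ℂ u v : H →L[ℂ] H) (e i)⟫_ℂ‖ₑ =
        ‖⟪e i, v⟫_ℂ‖ₑ * ‖⟪f i, u⟫_ℂ‖ₑ := by
      rw [InnerProductSpace.rankOne_apply, inner_smul_right, enorm_mul, ← inner_conj_symm v,
        RCLike.enorm_conj]
    rw [h1]
    exact ENNReal.rpow_le_self_of_le_one ((ENNReal.le_tsum i).trans hsum) hp
  exact (ENNReal.rpow_le_rpow key (one_div_pos.2 hp0).le).trans_eq (ENNReal.one_rpow _)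

namespace SchattenClass

variable {p : ℝ} [hp : Fact (1 ≤ p)]

/-- The element of `S_p(H)` with a given underlying operator. -/
noncomputable def ofOp (T : H →L[ℂ] H) (hT : schattenENorm p T < ⊤) : SchattenClass H p :=
  (⟨T, hT⟩ : schattenSubalgebra H p)

variable (p) in
/-- The operator `x ↦ ⟨v, x⟩ u` as an element of `S_p(H)`, for unit vectors `u`, `v`. -/
noncomputable def rankOne (u v : H) (hu : ‖u‖ = 1) (hv : ‖v‖ = 1) : SchattenClass H p :=
  ofOp (InnerProductSpace.rankOne ℂ u v)
    ((schattenENorm_rankOne_le hp.out hu.le hv.le).trans_lt ENNReal.one_lt_top)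

theorem toOp_rankOne_apply {u v : H} (hu : ‖u‖ = 1) (hv : ‖v‖ = 1) (x : H) :
    toOp (rankOne p u v hu hv) x = ⟪v, x⟫_ℂ • u := rfl

theorem norm_rankOne_le {u v : H} (hu : ‖u‖ = 1) (hv : ‖v‖ = 1) : ‖rankOne p u v hu hv‖ ≤ 1 :=
  ENNReal.toReal_le_of_le_ofReal zero_le_one
    ((schattenENorm_rankOne_le hp.out hu.le hv.le).trans_eq ENNReal.ofReal_one.symm)

variable (p) in
/-- The matrix coefficient `S ↦ ⟨u, S v⟩`. -/
noncomputable def coeff (u v : H) : StrongDual ℂ (SchattenClass H p) :=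
  LinearMap.mkContinuous
    { toFun := fun S => ⟪u, toOp S v⟫_ℂ
      map_add' := fun S T => by rw [toOp_add, add_apply, inner_add_right]
      map_smul' := fun c S => by rw [toOp_smul, smul_apply, inner_smul_right]; rfl } (‖u‖ * ‖v‖)
    fun S => calc
      ‖⟪u, toOp S v⟫_ℂ‖ ≤ ‖u‖ * ‖toOp S v‖ := norm_inner_le_norm _ _
      _ ≤ ‖u‖ * (‖S‖ * ‖v‖) := by
        gcongr
        exact ((toOp S).le_opNorm v).trans (by gcongr; exact norm_toOp_le S)
      _ = ‖u‖ * ‖v‖ * ‖S‖ := by ring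

theorem coeff_apply (u v : H) (S : SchattenClass H p) : coeff p u v S = ⟪u, toOp S v⟫_ℂ := rfl

theorem norm_coeff_le {u v : H} (hu : ‖u‖ = 1) (hv : ‖v‖ = 1) : ‖coeff p u v‖ ≤ 1 :=
  (LinearMap.mkContinuous_norm_le _ (by positivity) _).trans_eq (by rw [hu, hv, one_mul])

variable (H) in
/-- The contractive inclusion `S_p(H) ⊆ S_q(H)` for `p ≤ q`. -/
noncomputable def inclusion {q : ℝ} [Fact (1 ≤ q)] (hpq : p ≤ q) : SchattenClass H p →L[ℂ] SchattenClass H q :=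
  LinearMap.mkContinuous
    { toFun := fun S => ofOp (toOp S)
        ((schattenENorm_anti (zero_lt_one.trans_le hp.out) hpq _).trans_lt
          (schattenENorm_ne_top S).lt_top)
      map_add' := fun _ _ => rfl
      map_smul' := fun _ _ => rfl } 1
    fun S => by
      rw [one_mul]
      exact ENNReal.toReal_mono (schattenENorm_ne_top S)
        (schattenENorm_anti (zero_lt_one.trans_le hp.out) hpq _)

theorem toOp_inclusion {q : ℝ} [Fact (1 ≤ q)] (hpq : p ≤ q) (S : SchattenClass H p) :
    toOp (inclusion H hpq S) = toOp S := rfl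

/-- The Schatten norm does not grow under left multiplication by a contraction. The factor `P` is
only a bounded operator, so submultiplicativity inside the Schatten class would not suffice. -/
theorem norm_le_of_toOp_eq_mul {S T : SchattenClass H p} {P : H →L[ℂ] H} (hP : ‖P‖ ≤ 1)
    (h : toOp S = P * toOp T) : ‖S‖ ≤ ‖T‖ := by
  rw [norm_def, norm_def, h]
  exact ENNReal.toReal_mono (schattenENorm_ne_top T)
    (schattenENorm_mul_le_of_norm_le_one hp.out P hP (schattenENorm_ne_top T))

theorem toOp_sum {ι : Type*} (s : Finset ι) (S : ι → SchattenClass H p) :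
    toOp (∑ i ∈ s, S i) = ∑ i ∈ s, toOp (S i) :=
  map_sum (⟨⟨toOp, toOp_zero⟩, toOp_add⟩ : SchattenClass H p →+ (H →L[ℂ] H)) S s

/-! ### Finite-rank contractions that move matrix units. -/

variable {e : ℕ → H} (he : Orthonormal ℂ e)

/-- `S ↦ ∑_{k < n} ⟨eₖ, S eₙ⟩ eₖ ⊗ e₀`. -/
noncomputable def columnShift (n : ℕ) : SchattenClass H p →L[ℂ] SchattenClass H p :=
  ∑ k ∈ Finset.range n,
    (coeff p (e k) (e n)).smulRight (rankOne p (e k) (e 0) (he.1 k) (he.1 0))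

/-- `S ↦ ⟨eₘ, S e₀⟩ e₀ ⊗ e₀`. -/
noncomputable def cornerShift (m : ℕ) : SchattenClass H p →L[ℂ] SchattenClass H p :=
  (coeff p (e m) (e 0)).smulRight (rankOne p (e 0) (e 0) (he.1 0) (he.1 0))

theorem isCompactOperator_smulRight (φ : StrongDual ℂ (SchattenClass H p))
    (S : SchattenClass H p) : IsCompactOperator (φ.smulRight S) :=
  (isCompactOperator_of_locallyCompactSpace_rng
    (ContinuousLinearMap.toSpanSingleton ℂ S)).comp_clm φ

theorem isCompactOperator_cornerShift (m : ℕ) : IsCompactOperator (cornerShift (p := p) he m) :=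
  isCompactOperator_smulRight _ _

theorem isCompactOperator_columnShift (n : ℕ) : IsCompactOperator (columnShift (p := p) he n) :=
  Submodule.sum_mem (compactOperator (RingHom.id ℂ) (SchattenClass H p) (SchattenClass H p))
    fun _ _ => isCompactOperator_smulRight _ _

theorem norm_cornerShift_le (m : ℕ) : ‖cornerShift (p := p) he m‖ ≤ 1 := by
  rw [cornerShift, ContinuousLinearMap.norm_smulRight_apply]
  exact mul_le_one₀ (norm_coeff_le (he.1 m) (he.1 0)) (norm_nonneg _)
    (norm_rankOne_le (he.1 0) (he.1 0))

theorem columnShift_apply (n : ℕ) (S : SchattenClass H p) : columnShift he n S =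
    ∑ k ∈ Finset.range n, ⟪e k, toOp S (e n)⟫_ℂ • rankOne p (e k) (e 0) (he.1 k) (he.1 0) := by
  rw [columnShift, sum_apply]
  rfl

/-- A termwise estimate would grow with `n`. Instead the map factors as right multiplication by a
matrix unit, which moves column `n` to column `0`, followed by left multiplication by a projection,
which does the truncation. -/
theorem norm_columnShift_le (n : ℕ) : ‖columnShift (p := p) he n‖ ≤ 1 := by
  refine ContinuousLinearMap.opNorm_le_bound _ zero_le_one fun S => ?_
  have h : toOp (columnShift he n S) =
      (∑ k ∈ Finset.range n, (InnerProductSpace.rankOne ℂ (e k) (e k) : H →L[ℂ] H)) *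
        toOp (S * rankOne p (e n) (e 0) (he.1 n) (he.1 0)) := by
    ext x
    rw [columnShift_apply, toOp_sum, toOp_mul, mul_apply_eq_comp, mul_apply_eq_comp, sum_apply,
      sum_apply]
    refine Finset.sum_congr rfl fun k _ => ?_
    rw [toOp_smul, smul_apply, toOp_rankOne_apply, toOp_rankOne_apply, map_smul,
      InnerProductSpace.rankOne_apply, inner_smul_right, smul_smul, mul_comm]
  calc _ ≤ ‖S * rankOne p (e n) (e 0) (he.1 n) (he.1 0)‖ :=
        norm_le_of_toOp_eq_mul (norm_sum_rankOne_le he _) h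
    _ ≤ ‖S‖ * ‖rankOne p (e n) (e 0) (he.1 n) (he.1 0)‖ := norm_mul_le _ _
    _ ≤ ‖S‖ * 1 := by gcongr; exact norm_rankOne_le _ _
    _ = 1 * ‖S‖ := mul_comm _ _

/-- The bilinear form `(T, S) ↦ ⟨u, (T S) u⟩` on `B(S_q(H)) × S_p(H)`, for `p ≤ q`. -/
noncomputable def evalForm {q : ℝ} [Fact (1 ≤ q)] (hpq : p ≤ q) (u : H) :
    (SchattenClass H q →L[ℂ] SchattenClass H q) →L[ℂ] SchattenClass H p →L[ℂ] ℂ :=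
  ((ContinuousLinearMap.compL ℂ (SchattenClass H p) (SchattenClass H q) ℂ).flip
    (inclusion H hpq)) ∘L
      (ContinuousLinearMap.compL ℂ (SchattenClass H q) (SchattenClass H q) ℂ (coeff q u u))

theorem evalForm_apply {q : ℝ} [Fact (1 ≤ q)] (hpq : p ≤ q) (u : H)
    (T : SchattenClass H q →L[ℂ] SchattenClass H q) (S : SchattenClass H p) :
    evalForm hpq u T S = ⟪u, toOp (T (inclusion H hpq S)) u⟫_ℂ := rfl

/-- The matrix unit with entry in row `m` and column `n` survives the truncation exactly above the
diagonal, and is then carried to the corner where the form reads it. -/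
theorem evalForm_shift {q : ℝ} [Fact (1 ≤ q)] (hpq : p ≤ q) (m n : ℕ) :
    evalForm hpq (e 0) (cornerShift he m * columnShift he n)
      (rankOne p (e m) (e 0) (he.1 m) (he.1 0) * rankOne p (e 0) (e n) (he.1 0) (he.1 n)) =
        if m < n then 1 else 0 := by
  have hi := orthonormal_iff_ite.1 he
  set S := rankOne p (e m) (e 0) (he.1 m) (he.1 0) * rankOne p (e 0) (e n) (he.1 0) (he.1 n)
  have hS : toOp (inclusion H hpq S) (e n) = e m := by
    rw [toOp_inclusion, toOp_mul, mul_apply_eq_comp, toOp_rankOne_apply, toOp_rankOne_apply]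
    simp [he.1]
  -- Only the summand `k = m` is nonzero, and it occurs in `Finset.range n` exactly when `m < n`.
  have h1 : toOp (columnShift he n (inclusion H hpq S)) (e 0) = if m < n then e m else 0 := by
    rw [columnShift_apply, hS, toOp_sum, sum_apply]
    simp only [toOp_smul, smul_apply, toOp_rankOne_apply, hi]
    simp
  rw [evalForm_apply, mul_apply_eq_comp, cornerShift, ContinuousLinearMap.smulRight_apply,
    coeff_apply, h1, toOp_smul, smul_apply, toOp_rankOne_apply]
  split_ifs <;> simp [he.1]

end SchattenClass

end Schatten

/-! ### Conclusion. -/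

/-- An infinite-dimensional inner product space contains an orthonormal sequence. -/
theorem exists_orthonormal_nat {H : Type*} [NormedAddCommGroup H] [InnerProductSpace ℂ H]
    [CompleteSpace H] (hH : ¬ FiniteDimensional ℂ H) : ∃ e : ℕ → H, Orthonormal ℂ e := by
  obtain ⟨w, b, -⟩ := exists_hilbertBasis ℂ H
  have hw : Infinite w := by
    by_contra hfin
    rw [not_infinite_iff_finite] at hfin
    have := Fintype.ofFinite w
    exact hH b.toOrthonormalBasis.toBasis.finiteDimensional_of_finite
  exact ⟨fun n => b (Infinite.natEmbedding w n),
    b.orthonormal.comp _ (Infinite.natEmbedding w).injective⟩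

open SchattenClass in
theorem mainTheorem8 {H : Type*} [NormedAddCommGroup H] [InnerProductSpace ℂ H] [CompleteSpace H]
    (hH : ¬ FiniteDimensional ℂ H) (p : ℝ) [Fact (1 ≤ p)] (hp2 : p ≤ 2) :
    ¬ ArensRegular
        (ProjTensor (HilbertSchmidt H →L[ℂ] HilbertSchmidt H) (SchattenClass H p)) ∧
      ¬ ArensRegular
        (ProjTensor (compactOperators (HilbertSchmidt H)) (SchattenClass H p)) := by
  obtain ⟨e, he⟩ := exists_orthonormal_nat hH
  constructor
  · exact ProjTensor.not_arensRegular (evalForm hp2 (e 0)) (norm_cornerShift_le he)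
      (norm_columnShift_le he) (fun m => norm_rankOne_le (he.1 m) (he.1 0))
      (fun n => norm_rankOne_le (he.1 0) (he.1 n)) (evalForm_shift he hp2)
  -- The inclusion into all bounded operators pulls the bilinear form back to the compact ones, and
  -- both families of shifts are compact, so the matrix of values is unchanged.
  · let j : compactOperators (HilbertSchmidt H) →L[ℂ] (HilbertSchmidt H →L[ℂ] HilbertSchmidt H) :=
      LinearMap.mkContinuous
        { toFun := Subtype.val, map_add' := fun _ _ => rfl, map_smul' := fun _ _ => rfl } 1
        fun T => (one_mul ‖T‖).symm.le
    exact ProjTensor.not_arensRegular (evalForm hp2 (e 0) ∘L j)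
      (a := fun m => ⟨cornerShift he m, isCompactOperator_cornerShift he m⟩)
      (a' := fun n => ⟨columnShift he n, isCompactOperator_columnShift he n⟩)
      (norm_cornerShift_le he) (norm_columnShift_le he)
      (fun m => norm_rankOne_le (he.1 m) (he.1 0))
      (fun n => norm_rankOne_le (he.1 0) (he.1 n)) (evalForm_shift he hp2)
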